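/- Let $N\ge 2$ be an integer and let $a,b\in\mathbb R$ satisfy $\left(\frac N2-a\right)^2\ge N+1$. Let $X_{a,b}(\mathbb R^N)$ be the set of (real- or complex-valued) vector fields $\mathbf U\in C^\infty(\mathbb R^N\setminus\{0\})^N$ such that $$\int_{\mathbb R^N}\frac{|\nabla\mathbf U|^2}{|x|^{2a}}\,dx<\infty,\qquad \int_{\mathbb R^N}\frac{|\mathbf U|^2}{|x|^{2b}}\,dx<\infty,\qquad \int_{\mathbb R^N}\frac{|\mathbf U|^2}{|x|^{a+b+1}}\,dx<\infty,$$ and such that $|x|^{-1+\frac N2-a}\,\mathbf U(x)\to0$ and $|x|^{-b+\frac N2}\,\mathbf U(x)\to 0$, both as $|x|\to0$ and as $|x|\to\infty$. Here $|\nabla\mathbf U|^2=\sum_{j,k}|\partial U_k/\partial x_j|^2$, and $\operatorname{curl}\mathbf U=0$ means that $\partial U_k/\partial x_j=\partial U_j/\partial x_k$ on $\mathbb R^N\setminus\{0\}$ for all $j,k$. Put $$\rho=\sqrt{\left(1-\tfrac N2+a\right)^2+N-1}.$$ (1) If $a-b+1>0$, then for every $\mathbf U\in X_{a,b}(\mathbb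 R^N)$ with $\operatorname{curl}\mathbf U=0$, $$\int_{\mathbb R^N}\frac{|\nabla\mathbf U|^2}{|x|^{2a}}\,dx\int_{\mathbb R^N}\frac{|\mathbf U|^2}{|x|^{2b}}\,dx\ \ge\ C^2\left(\int_{\mathbb R^N}\frac{|\mathbf U|^2}{|x|^{a+b+1}}\,dx\right)^2,\qquad C=\rho+\frac{a-b+1}2 .$$ The constant $C^2$ is sharp (no larger constant is possible). For all $\gamma\in\mathbb R$ and $\beta>0$ the field $$\mathbf U(x)=\gamma\,|x|^{-\frac N2+a+\rho}\,e^{-\frac{\beta}{a-b+1}|x|^{a-b+1}}\,x$$ is curl-free, belongs to $X_{a,b}(\mathbb R^N)$ and gives equality; for $\gamma\ne0$ the integral $\int|\mathbf U|^2|x|^{-(a+b+1)}\,dx$ is positive, so that the constant is attained. (2) If $a-b+1<0$, then the same inequality holds for every $\mathbf U\in X_{a,b}(\mathbb R^N)$ with $\operatorname{curl}\mathbf U=0$, with $$C=\rho-\frac{a-b+1}2 .$$ The constant $C^2$ is sharp. For all $\gamma\in\mathbb R$ and $\beta<0$ the field $$\mathbf U(x)=\gamma\,|x|^{-\frac N2+a-\rho}\,e^{-\frac{\beta}{a-b+1}|x|^{a-b+1}}\,x$$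 is curl-free, belongs to $X_{a,b}(\mathbb R^N)$ and gives equality; for $\gamma\ne0$ the integral $\int|\mathbf U|^2|x|^{-(a+b+1)}\,dx$ is positive, so that the constant is attained. -/

import Mathlib

open Filter Topology MeasureTheory
open scoped ContDiff

noncomputable section

namespace CKN

/-- Vector fields on `ℝᴺ` with real (`𝕜 = ℝ`) or complex (`𝕜 = ℂ`) components.
The value at the origin is irrelevant in everything below. -/
abbrev Field (𝕜 : Type*) (N : ℕ) : Type _ :=
  EuclideanSpace ℝ (Fin N) → EuclideanSpace 𝕜 (Fin N)

variable {𝕜 : Type*} [RCLike 𝕜] {N : ℕ}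

/-- The partial derivative `∂U_k / ∂x_j` at the point `x`. -/
def pderiv (U : Field 𝕜 N) (j k : Fin N) (x : EuclideanSpace ℝ (Fin N)) : 𝕜 :=
  (fderiv ℝ U x (EuclideanSpace.single j (1 : ℝ))) k

/-- `|∇U|² = ∑_{j,k} |∂U_k / ∂x_j|²` at the point `x`. -/
def gradSq (U : Field 𝕜 N) (x : EuclideanSpace ℝ (Fin N)) : ℝ :=
  ∑ j, ∑ k, ‖pderiv U j k x‖ ^ 2

/-- `curl U = 0` on `ℝᴺ \ {0}`: the 1-form `∑ U_j dx_j` is closed there. -/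
def CurlFree (U : Field 𝕜 N) : Prop :=
  ∀ x : EuclideanSpace ℝ (Fin N), x ≠ 0 → ∀ j k : Fin N, pderiv U j k x = pderiv U k j x

/-- The density `|∇U|² / |x|^{2a}`. -/
def gradDensity (a : ℝ) (U : Field 𝕜 N) (x : EuclideanSpace ℝ (Fin N)) : ℝ :=
  gradSq U x / ‖x‖ ^ (2 * a)

/-- The density `|U|² / |x|^p`. -/
def density (p : ℝ) (U : Field 𝕜 N) (x : EuclideanSpace ℝ (Fin N)) : ℝ :=
  ‖U x‖ ^ 2 / ‖x‖ ^ p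

/-- The class `X_{a,b}(ℝᴺ)`. -/
structure MemX (a b : ℝ) (U : Field 𝕜 N) : Prop where
  smooth : ContDiffOn ℝ ∞ U {0}ᶜ
  integrable_grad : Integrable (gradDensity a U)
  integrable_left : Integrable (density (2 * b) U)
  integrable_mid : Integrable (density (a + b + 1) U)
  tendsto_zero_a : Tendsto (fun x => ‖x‖ ^ (-1 + (N : ℝ) / 2 - a) • U x) (𝓝[≠] 0) (𝓝 0)
  tendsto_infty_a :
    Tendsto (fun x => ‖x‖ ^ (-1 + (N : ℝ) / 2 - a) • U x) (Bornology.cobounded _) (𝓝 0)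
  tendsto_zero_b : Tendsto (fun x => ‖x‖ ^ (-b + (N : ℝ) / 2) • U x) (𝓝[≠] 0) (𝓝 0)
  tendsto_infty_b :
    Tendsto (fun x => ‖x‖ ^ (-b + (N : ℝ) / 2) • U x) (Bornology.cobounded _) (𝓝 0)

/-- `K` is admissible if `∫ |∇U|²/|x|^{2a} · ∫ |U|²/|x|^{2b} ≥ K (∫ |U|²/|x|^{a+b+1})²`
for every curl-free `U` in `X_{a,b}(ℝᴺ)`. -/
def Admissible (𝕜 : Type*) [RCLike 𝕜] (N : ℕ) (a b K : ℝ) : Prop :=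
  ∀ U : Field 𝕜 N, MemX a b U → CurlFree U →
    (∫ x, gradDensity a U x) * (∫ x, density (2 * b) U x) ≥
      K * (∫ x, density (a + b + 1) U x) ^ 2

/-- The field `γ |x|^p e^{-(β/q)|x|^q} x`. -/
def radialField (𝕜 : Type*) [RCLike 𝕜] (N : ℕ) (p q γ β : ℝ) : Field 𝕜 N := fun x =>
  WithLp.toLp 2 fun i =>
    ((γ * ‖x‖ ^ p * Real.exp (-(β / q) * ‖x‖ ^ q) * x i : ℝ) : 𝕜)

/-- `U` is a curl-free field of `X_{a,b}(ℝᴺ)` for which equality holds with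
the constant `K`. -/
def IsExtremal (a b K : ℝ) (U : Field 𝕜 N) : Prop :=
  MemX a b U ∧ CurlFree U ∧
    (∫ x, gradDensity a U x) * (∫ x, density (2 * b) U x) =
      K * (∫ x, density (a + b + 1) U x) ^ 2

/-- The number `√((1 - N/2 + a)² + N - 1)`. -/
def rate (N : ℕ) (a : ℝ) : ℝ :=
  √((1 - (N : ℝ) / 2 + a) ^ 2 + (N : ℝ) - 1)

end CKN

end

/-!
Write `s = a + 1 - N/2`, `q = a - b + 1`, `ε = sign q`, `ρ = rate N a`, `D = x · ∇`, and `A`, `B`,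
`M` for the three integrals of the statement. By the discriminant, `A B ≥ C² M²` follows once
`A + β² B ≥ 2 |β| C M` is known for every `β` of the sign of `q`.

Completing the square `|DU - (s + ερ) U + β |x|^q U|²` and integrating the exact radial derivatives
by parts reduces this inequality to a statement without `β`: against radial weights, the spherical
part of `|∇U|²` dominates `(N - 1) |U|²`. This fails on a single sphere, as constant fields show, and
the radial variation of the field has to be used. Let `T` and `P` be the parts of `U` and `DU`
tangential to the spheres. Up to divergences of tangential fields, which integrate to zero against
every radial cutoff (`Null`), closedness of `U` gives
`|∇_σ U|² - (N - 1) |U|² ≥ |P - T|² - (N + 1) |T|²`.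
For `N ≥ 3` this is the argument of Lichnerowicz for the first eigenvalue of the sphere: the null
identity `ClosedForm.null_commutator`, which comes from the commutators of the rotations
`x_i ∂_j - x_j ∂_i`, combined with Cauchy–Schwarz for the trace of the tangential block of the
Jacobian (`sq_trace_tangential_le`). For `N = 2` that block has size one and the identity carries
no information; there Wirtinger's inequality on circles takes over. It requires the circulation of
`U` around the origin to vanish, which is forced by the decay at `0` or at infinity. Since `P` is
the Euler derivative of `T`, integrating `|P - T|²` along the radii produces at least
`(s - 1)² |T|²`, and `(s - 1)² = (N/2 - a)² ≥ N + 1` is the hypothesis of the theorem.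

All this is done on `ℝᴺ` against smooth radial cutoffs (`ClosedForm.integral_quadDensity_ge`), so no
integration over spheres is needed. The cutoffs are removed by scaling: the boundary terms are
integrals against `|x|^{-N} dx`, which is invariant under dilations, and the pointwise decay in the
definition of the class makes them vanish in the limit (`integral_nonneg_of_cutoff`). Real and
imaginary parts are treated separately and added, as the form is quadratic.

For the radial fields the completed squares vanish; the three integrals are values of the Gamma
function after the substitution `y = |x|^q`, and `Γ(z + 1) = z Γ(z)` gives equality.
-/

noncomputable section

namespace CKN

/-! ### Integration by parts against radial cutoffs -/

/-- The Euclidean space on which all fields live. -/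
abbrev Pt (N : ℕ) : Type := EuclideanSpace ℝ (Fin N)

/-- The partial derivative `∂F / ∂x_j` of a scalar function. -/
def partialD {N : ℕ} (F : Pt N → ℝ) (j : Fin N) (x : Pt N) : ℝ :=
  fderiv ℝ F x (EuclideanSpace.single j (1 : ℝ))

/-- Smooth functions on the punctured space; nothing is said about the value at the origin. -/
def SmoothOff {N : ℕ} (F : Pt N → ℝ) : Prop := ContDiffOn ℝ ∞ F {0}ᶜ

section SmoothOff

variable {N : ℕ} {F G : Pt N → ℝ} {x : Pt N}

lemma SmoothOff.contDiffAt (hF : SmoothOff F) (hx : x ≠ 0) : ContDiffAt ℝ ∞ F x :=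
  ContDiffOn.contDiffAt hF (isOpen_compl_singleton.mem_nhds hx)

lemma SmoothOff.differentiableAt (hF : SmoothOff F) (hx : x ≠ 0) : DifferentiableAt ℝ F x :=
  (hF.contDiffAt hx).differentiableAt (by simp)

lemma SmoothOff.continuousOn (hF : SmoothOff F) : ContinuousOn F {0}ᶜ :=
  ContDiffOn.continuousOn hF

lemma SmoothOff.sub (hF : SmoothOff F) (hG : SmoothOff G) : SmoothOff fun x => F x - G x :=
  ContDiffOn.sub hF hG

lemma SmoothOff.mul (hF : SmoothOff F) (hG : SmoothOff G) : SmoothOff fun x => F x * G x :=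
  ContDiffOn.mul hF hG

lemma SmoothOff.sum {ι : Type*} {s : Finset ι} {F : ι → Pt N → ℝ}
    (hF : ∀ i ∈ s, SmoothOff (F i)) : SmoothOff fun x => ∑ i ∈ s, F i x :=
  ContDiffOn.sum hF

lemma smoothOff_const (c : ℝ) : SmoothOff fun _ : Pt N => c := contDiffOn_const

lemma smoothOff_coord (i : Fin N) : SmoothOff fun x : Pt N => x i :=
  (contDiff_euclidean.1 contDiff_id i).contDiffOn

lemma smoothOff_norm_rpow (m : ℝ) : SmoothOff fun x : Pt N => ‖x‖ ^ m := by
  intro x hx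
  exact ((contDiffAt_norm ℝ hx).rpow_const_of_ne (norm_ne_zero_iff.2 hx)).contDiffWithinAt

lemma SmoothOff.partialD (hF : SmoothOff F) (j : Fin N) : SmoothOff (partialD F j) := by
  have : ContDiffOn ℝ ∞ (fderiv ℝ F) {0}ᶜ :=
    ContDiffOn.fderiv_of_isOpen hF isOpen_compl_singleton (by simp)
  exact this.clm_apply contDiffOn_const

lemma partialD_coord (i j : Fin N) :
    partialD (fun x : Pt N => x i) j x = if j = i then 1 else 0 := by
  have : HasFDerivAt (fun x : Pt N => x i) (EuclideanSpace.proj (𝕜 := ℝ) i) x :=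
    (EuclideanSpace.proj (𝕜 := ℝ) i).hasFDerivAt
  rw [partialD, this.fderiv]
  simp [eq_comm]

lemma partialD_sub (hF : DifferentiableAt ℝ F x) (hG : DifferentiableAt ℝ G x) (j : Fin N) :
    partialD (fun x => F x - G x) j x = partialD F j x - partialD G j x := by
  simp [partialD, fderiv_fun_sub hF hG]

lemma partialD_mul (hF : DifferentiableAt ℝ F x) (hG : DifferentiableAt ℝ G x) (j : Fin N) :
    partialD (fun x => F x * G x) j x = partialD F j x * G x + F x * partialD G j x := by
  simp [partialD, fderiv_fun_mul hF hG]; ring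

lemma partialD_sum {ι : Type*} {s : Finset ι} {F : ι → Pt N → ℝ}
    (hF : ∀ i ∈ s, DifferentiableAt ℝ (F i) x) (j : Fin N) :
    partialD (fun x => ∑ i ∈ s, F i x) j x = ∑ i ∈ s, partialD (F i) j x := by
  simp [partialD, fderiv_fun_sum hF]

lemma partialD_norm_rpow (hx : x ≠ 0) (m : ℝ) (j : Fin N) :
    partialD (fun x : Pt N => ‖x‖ ^ m) j x = m * ‖x‖ ^ (m - 2) * x j := by
  have hn : ‖x‖ ≠ 0 := norm_ne_zero_iff.2 hx
  have h1 : HasFDerivAt (fun x : Pt N => ‖x‖ ^ 2) (2 • innerSL ℝ x) x :=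
    (hasStrictFDerivAt_norm_sq x).hasFDerivAt
  have h2 := h1.rpow_const (p := m / 2) (Or.inl (by positivity))
  have h3 : (fun x : Pt N => (‖x‖ ^ 2) ^ (m / 2)) = fun x => ‖x‖ ^ m := by
    ext y
    rw [← Real.rpow_natCast, ← Real.rpow_mul (norm_nonneg y)]; congr 1; push_cast; ring
  rw [h3] at h2
  rw [partialD, h2.fderiv]
  have h4 : (‖x‖ ^ 2) ^ (m / 2 - 1) = ‖x‖ ^ (m - 2) := by
    rw [← Real.rpow_natCast, ← Real.rpow_mul (norm_nonneg x)]; congr 1; push_cast; ring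
  simp [h4, EuclideanSpace.inner_single_right]
  ring

lemma two_le_infty : (2 : WithTop ℕ∞) ≤ ∞ :=
  WithTop.coe_le_coe.2 (le_top : (2 : ℕ∞) ≤ ⊤)

lemma partialD_comm (hF : SmoothOff F) (hx : x ≠ 0) (i j : Fin N) :
    partialD (partialD F i) j x = partialD (partialD F j) i x := by
  have hs : IsSymmSndFDerivAt ℝ F x := (hF.contDiffAt hx).isSymmSndFDerivAt (by simpa using two_le_infty)
  have hd : DifferentiableAt ℝ (fderiv ℝ F) x :=
    ((hF.contDiffAt hx).fderiv_right (m := 1) (by norm_num; exact two_le_infty)).differentiableAt (by simp)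
  have key : ∀ i j : Fin N, partialD (partialD F i) j x =
      fderiv ℝ (fderiv ℝ F) x (EuclideanSpace.single j 1) (EuclideanSpace.single i 1) := by
    intro i j
    have : HasFDerivAt (partialD F i)
        ((fderiv ℝ (fderiv ℝ F) x).flip (EuclideanSpace.single i 1)) x := by
      have := hd.hasFDerivAt.clm_apply
        (hasFDerivAt_const (EuclideanSpace.single i (1 : ℝ) : Pt N) x)
      simpa using! this
    rw [partialD, this.fderiv]; rfl
  rw [key, key]
  exact hs _ _

/-- The Euler derivative `x · ∇F`. -/
def euler (F : Pt N → ℝ) (x : Pt N) : ℝ := ∑ j, x j * partialD F j x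

lemma SmoothOff.euler (hF : SmoothOff F) : SmoothOff (euler F) :=
  SmoothOff.sum fun j _ => (smoothOff_coord j).mul (hF.partialD j)

end SmoothOff

/-- A test function supported away from the origin whose gradient is parallel to `x`. -/
structure RadialCutoff {N : ℕ} (χ : Pt N → ℝ) : Prop where
  smooth : ContDiff ℝ ∞ χ
  compact : HasCompactSupport χ
  zero : (0 : Pt N) ∉ tsupport χ
  radial : ∀ (x : Pt N) (i j : Fin N), x i * partialD χ j x = x j * partialD χ i x

section Cutoff

variable {N : ℕ} {χ F G : Pt N → ℝ}

lemma continuous_mul_of_tsupport (hχ : Continuous χ) (h0 : (0 : Pt N) ∉ tsupport χ)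
    (hF : ContinuousOn F {0}ᶜ) : Continuous fun x => χ x * F x := by
  rw [continuous_iff_continuousAt]
  intro x
  by_cases hx : x = 0
  · subst hx
    have : (fun x => χ x * F x) =ᶠ[𝓝 0] fun _ => 0 := by
      filter_upwards [notMem_tsupport_iff_eventuallyEq.1 h0] with y hy
      simp [hy]
    exact continuousAt_const.congr this.symm
  · exact hχ.continuousAt.mul (hF.continuousAt (isOpen_compl_singleton.mem_nhds hx))

lemma integrable_mul_of_tsupport (hχ : Continuous χ) (hc : HasCompactSupport χ)
    (h0 : (0 : Pt N) ∉ tsupport χ) (hF : ContinuousOn F {0}ᶜ) :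
    Integrable fun x => χ x * F x :=
  (continuous_mul_of_tsupport hχ h0 hF).integrable_of_hasCompactSupport hc.mul_right

lemma RadialCutoff.integrable_mul (hχ : RadialCutoff χ) (hF : ContinuousOn F {0}ᶜ) :
    Integrable fun x => χ x * F x :=
  integrable_mul_of_tsupport hχ.smooth.continuous hχ.compact hχ.zero hF

lemma tsupport_partialD_subset (χ : Pt N → ℝ) (j : Fin N) :
    tsupport (partialD χ j) ⊆ tsupport χ :=
  closure_minimal ((fun x hx => by
    have : fderiv ℝ χ x ≠ 0 := fun h => hx (by simp [partialD, h])
    exact support_fderiv_subset ℝ this)) (isClosed_tsupport _)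

lemma RadialCutoff.continuous_partialD (hχ : RadialCutoff χ) (j : Fin N) :
    Continuous (partialD χ j) :=
  (hχ.smooth.continuous_fderiv (by simp)).clm_apply continuous_const

lemma RadialCutoff.integrable_partialD_mul (hχ : RadialCutoff χ) (hF : ContinuousOn F {0}ᶜ)
    (j : Fin N) : Integrable fun x => partialD χ j x * F x :=
  integrable_mul_of_tsupport (hχ.continuous_partialD j)
    (hχ.compact.of_isClosed_subset (isClosed_tsupport _) (tsupport_partialD_subset χ j))
    (fun h => hχ.zero (tsupport_partialD_subset χ j h)) hF

lemma RadialCutoff.integral_mul_partialD (hχ : RadialCutoff χ) (hF : SmoothOff F) (j : Fin N) :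
    ∫ x, χ x * partialD F j x = -∫ x, partialD χ j x * F x := by
  refine integral_mul_fderiv_eq_neg_fderiv_mul_of_integrable
    (hχ.integrable_partialD_mul hF.continuousOn j)
    (hχ.integrable_mul (hF.partialD j).continuousOn) (hχ.integrable_mul hF.continuousOn)
    (fun x _ => hχ.smooth.differentiable (by simp) x) fun x hx => hF.differentiableAt ?_
  rintro rfl
  exact hχ.zero hx

/-- Functions that integrate to zero against every radial cutoff, such as divergences of fields
tangential to the spheres `|x| = r`. -/
structure Null (F : Pt N → ℝ) : Prop where
  continuousOn : ContinuousOn F {0}ᶜ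
  integral_eq_zero : ∀ χ : Pt N → ℝ, RadialCutoff χ → ∫ x, χ x * F x = 0

lemma ae_ne_zero [NeZero N] : ∀ᵐ x : Pt N, x ≠ 0 := by simp [ae_iff, measure_singleton]

lemma integral_congr_off [NeZero N] {F G : Pt N → ℝ} (h : ∀ x, x ≠ 0 → F x = G x) :
    ∫ x, F x = ∫ x, G x := by
  refine integral_congr_ae ?_
  filter_upwards [ae_ne_zero] with x hx using h x hx

lemma Null.congr [NeZero N] (hF : Null F) (h : ∀ x, x ≠ 0 → F x = G x) : Null G := by
  refine ⟨hF.continuousOn.congr fun x hx => (h x hx).symm, fun χ hχ => ?_⟩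
  rw [← hF.integral_eq_zero χ hχ]
  exact integral_congr_off fun x hx => by rw [h x hx]

lemma Null.add (hF : Null F) (hG : Null G) : Null fun x => F x + G x := by
  refine ⟨hF.continuousOn.add hG.continuousOn, fun χ hχ => ?_⟩
  simp_rw [mul_add]
  rw [integral_add (hχ.integrable_mul hF.continuousOn) (hχ.integrable_mul hG.continuousOn),
    hF.integral_eq_zero χ hχ, hG.integral_eq_zero χ hχ, add_zero]

lemma Null.const_mul (hF : Null F) (c : ℝ) : Null fun x => c * F x := by
  refine ⟨continuousOn_const.mul hF.continuousOn, fun χ hχ => ?_⟩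
  simp_rw [mul_left_comm _ c]
  rw [integral_const_mul, hF.integral_eq_zero χ hχ, mul_zero]

lemma Null.sum {ι : Type*} {s : Finset ι} {F : ι → Pt N → ℝ} (hF : ∀ i ∈ s, Null (F i)) :
    Null fun x => ∑ i ∈ s, F i x := by
  refine ⟨continuousOn_finsetSum _ fun i hi => (hF i hi).continuousOn, fun χ hχ => ?_⟩
  simp_rw [Finset.mul_sum]
  rw [integral_finsetSum _ fun i hi => hχ.integrable_mul (hF i hi).continuousOn]
  exact Finset.sum_eq_zero fun i hi => (hF i hi).integral_eq_zero χ hχ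

/-- The rotational derivatives `x_i ∂_j - x_j ∂_i` are tangential to the spheres. -/
lemma null_rotation [NeZero N] (hF : SmoothOff F) (i j : Fin N) :
    Null fun x => x i * partialD F j x - x j * partialD F i x := by
  refine ⟨(((smoothOff_coord i).mul (hF.partialD j)).sub
    ((smoothOff_coord j).mul (hF.partialD i))).continuousOn, fun χ hχ => ?_⟩
  have h1 : ∀ i j : Fin N, Integrable fun x : Pt N => χ x * partialD (fun x => x i * F x) j x :=
    fun i j => hχ.integrable_mul (((smoothOff_coord i).mul hF).partialD j).continuousOn
  have h2 : ∀ i j : Fin N, Integrable fun x : Pt N => partialD χ j x * (x i * F x) :=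
    fun i j => hχ.integrable_partialD_mul ((smoothOff_coord i).mul hF).continuousOn j
  calc ∫ x, χ x * (x i * partialD F j x - x j * partialD F i x)
      = ∫ x, (χ x * partialD (fun x => x i * F x) j x
          - χ x * partialD (fun x => x j * F x) i x) := by
        refine integral_congr_off fun x hx => ?_
        rw [partialD_mul ((smoothOff_coord i).differentiableAt hx) (hF.differentiableAt hx),
          partialD_mul ((smoothOff_coord j).differentiableAt hx) (hF.differentiableAt hx),
          partialD_coord, partialD_coord]
        simp only [eq_comm (a := i)]
        ring
    _ = -∫ x, (partialD χ j x * (x i * F x) - partialD χ i x * (x j * F x)) := by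
        rw [integral_sub (h1 i j) (h1 j i), integral_sub (h2 i j) (h2 j i),
          hχ.integral_mul_partialD ((smoothOff_coord i).mul hF),
          hχ.integral_mul_partialD ((smoothOff_coord j).mul hF)]
        ring
    _ = 0 := by
        rw [neg_eq_zero, ← integral_zero (Pt N) ℝ]
        refine integral_congr_off fun x _ => ?_
        linear_combination F x * hχ.radial x i j

/-- The Euler derivative of a cutoff weighted by a power of `|x|`, moved onto the cutoff. -/
lemma RadialCutoff.integral_euler [NeZero N] (hχ : RadialCutoff χ) (hF : SmoothOff F) (m : ℝ) :
    ∫ x, χ x * (‖x‖ ^ m * (euler F x + (m + N) * F x)) =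
      -∫ x, euler χ x * (‖x‖ ^ m * F x) := by
  have hm : ∀ j : Fin N, SmoothOff fun x : Pt N => x j * (‖x‖ ^ m * F x) := fun j =>
    (smoothOff_coord j).mul ((smoothOff_norm_rpow m).mul hF)
  have hsum : ∀ x : Pt N, x ≠ 0 → χ x * (‖x‖ ^ m * (euler F x + (m + N) * F x)) =
      ∑ j, χ x * partialD (fun x => x j * (‖x‖ ^ m * F x)) j x := by
    intro x hx
    have hj : ∀ j : Fin N, partialD (fun x : Pt N => x j * (‖x‖ ^ m * F x)) j x =
        ‖x‖ ^ m * F x + m * ‖x‖ ^ (m - 2) * F x * x j ^ 2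
          + ‖x‖ ^ m * (x j * partialD F j x) := by
      intro j
      rw [partialD_mul ((smoothOff_coord j).differentiableAt hx)
          (((smoothOff_norm_rpow m).mul hF).differentiableAt hx), partialD_coord,
        partialD_mul ((smoothOff_norm_rpow m).differentiableAt hx) (hF.differentiableAt hx),
        partialD_norm_rpow hx]
      simp only [if_true]
      ring
    have hn : ‖x‖ ^ (m - 2) * ∑ j, x j ^ 2 = ‖x‖ ^ m := by
      rw [← EuclideanSpace.real_norm_sq_eq, ← Real.rpow_natCast,
        ← Real.rpow_add (norm_pos_iff.2 hx)]
      congr 1; push_cast; ring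
    simp_rw [hj, ← Finset.mul_sum, Finset.sum_add_distrib, ← Finset.mul_sum]
    simp only [Finset.sum_const, Finset.card_univ, Fintype.card_fin, nsmul_eq_mul, euler]
    linear_combination -(χ x * m * F x) * hn
  rw [integral_congr_off hsum, integral_finsetSum _ fun j _ =>
    hχ.integrable_mul ((hm j).partialD j).continuousOn]
  simp_rw [fun j => hχ.integral_mul_partialD (hm j) j]
  rw [Finset.sum_neg_distrib, ← integral_finsetSum _ fun j _ =>
    hχ.integrable_partialD_mul (hm j).continuousOn j]
  congr 1
  refine integral_congr_off fun x _ => ?_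
  rw [euler, Finset.sum_mul]
  exact Finset.sum_congr rfl fun j _ => by ring

lemma RadialCutoff.norm_rpow_mul (hχ : RadialCutoff χ) (m : ℝ) :
    RadialCutoff fun x => ‖x‖ ^ m * χ x := by
  have hz : ∀ᶠ x in 𝓝 (0 : Pt N), χ x = 0 := notMem_tsupport_iff_eventuallyEq.1 hχ.zero
  have hz' : (fun x : Pt N => ‖x‖ ^ m * χ x) =ᶠ[𝓝 0] fun _ => 0 := by
    filter_upwards [hz] with x hx; simp [hx]
  refine ⟨contDiff_iff_contDiffAt.2 fun x => ?_, hχ.compact.mul_left, ?_, fun x i j => ?_⟩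
  · by_cases hx : x = 0
    · subst hx; exact contDiffAt_const.congr_of_eventuallyEq hz'
    · exact ((smoothOff_norm_rpow m).contDiffAt hx).mul hχ.smooth.contDiffAt
  · exact notMem_tsupport_iff_eventuallyEq.2 hz'
  · by_cases hx : x = 0
    · subst hx; simp
    · have hd : DifferentiableAt ℝ χ x := hχ.smooth.differentiable (by simp) x
      have hd' := (smoothOff_norm_rpow m).differentiableAt hx
      rw [partialD_mul hd' hd, partialD_mul hd' hd, partialD_norm_rpow hx, partialD_norm_rpow hx]
      linear_combination ‖x‖ ^ m * hχ.radial x i j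

end Cutoff

/-! ### Null expressions of a closed one-form -/

section Algebra

variable {N : ℕ} (x u : Fin N → ℝ) {S : Fin N → Fin N → ℝ}

lemma sum_rotation_minors (hS : ∀ i j, S i j = S j i) :
    ∑ j, ∑ i, ∑ k, ((x i * S j i - x j * S i i) * (x k * S j k - x j * S k k)
        - (x k * S j i - x j * S k i) * (x i * S j k - x j * S i k)) =
      ∑ j, ((∑ i, x i * S i j) - x j * ∑ i, S i i) ^ 2
        - ((∑ i, x i ^ 2) * (∑ i, ∑ j, S i j ^ 2) - ∑ j, (∑ i, x i * S i j) ^ 2) := by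
  have h1 : ∀ j, ∑ i, ∑ k, ((x i * S j i - x j * S i i) * (x k * S j k - x j * S k k)
        - (x k * S j i - x j * S k i) * (x i * S j k - x j * S i k)) =
      ((∑ i, x i * S i j) - x j * ∑ i, S i i) ^ 2 - (∑ i, x i * S i j) ^ 2
        + 2 * x j * (∑ i, S j i * ∑ k, x k * S k i) - x j ^ 2 * ∑ i, ∑ k, S i k ^ 2 := by
    intro j
    have e1 : (∑ i, x i * S i j) - x j * ∑ i, S i i = ∑ i, (x i * S j i - x j * S i i) := by
      rw [Finset.sum_sub_distrib, Finset.mul_sum]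
      simp_rw [hS j]
    have e2 : (∑ i, x i * S i j) ^ 2 = ∑ i, ∑ k, (x i * S j i) * (x k * S j k) := by
      rw [sq, Finset.sum_mul_sum]; simp_rw [hS j]
    have e3 : ∑ i, S j i * ∑ k, x k * S k i = ∑ i, ∑ k, S j i * (x k * S i k) := by
      simp_rw [Finset.mul_sum]
      exact Finset.sum_congr rfl fun i _ => Finset.sum_congr rfl fun k _ => by rw [hS k i]
    have e4 : ∑ i, S j i * ∑ k, x k * S k i = ∑ i, ∑ k, S j k * (x i * S i k) := by
      rw [e3, Finset.sum_comm]
      exact Finset.sum_congr rfl fun i _ => Finset.sum_congr rfl fun k _ => by rw [hS k i]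
    have e5 : 2 * x j * (∑ i, S j i * ∑ k, x k * S k i) =
        x j * (∑ i, ∑ k, S j i * (x k * S i k)) + x j * ∑ i, ∑ k, S j k * (x i * S i k) := by
      rw [← e3, ← e4]; ring
    rw [e1, e2, sq, Finset.sum_mul_sum, e5]
    simp_rw [Finset.mul_sum, ← Finset.sum_sub_distrib, ← Finset.sum_add_distrib,
      ← Finset.sum_sub_distrib]
    exact Finset.sum_congr rfl fun i _ => Finset.sum_congr rfl fun k _ => by
      rw [hS k i]; ring
  have h2 : ∑ j, x j * (∑ i, S j i * ∑ k, x k * S k i) = ∑ j, (∑ i, x i * S i j) ^ 2 := by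
    simp_rw [Finset.mul_sum]
    rw [Finset.sum_comm]
    simp_rw [sq, Finset.sum_mul, Finset.mul_sum]
    exact Finset.sum_congr rfl fun i _ => Finset.sum_congr rfl fun k _ =>
      Finset.sum_congr rfl fun l _ => by ring
  simp_rw [h1, mul_assoc, Finset.sum_sub_distrib, Finset.sum_add_distrib,
    Finset.sum_sub_distrib, ← Finset.mul_sum, h2, ← Finset.sum_mul]
  ring

lemma sum_rotation_commutators (hS : ∀ i j, S i j = S j i) :
    ∑ j, ∑ i, ∑ k, u i * (x i * (if j = k then 1 else 0) * S j k
        - x k * (if j = i then 1 else 0) * S j k - x i * S k k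
        + x j * (if j = i then 1 else 0) * S k k + x k * S i k
        - x j * (if j = k then 1 else 0) * S i k) =
      (N - 2) * ((∑ i, u i * ∑ k, x k * S k i) - (∑ i, x i * u i) * ∑ k, S k k) := by
  rw [Finset.sum_comm]
  have h1 : ∀ i, ∑ j, ∑ k, u i * (x i * (if j = k then 1 else 0) * S j k
        - x k * (if j = i then 1 else 0) * S j k - x i * S k k
        + x j * (if j = i then 1 else 0) * S k k + x k * S i k
        - x j * (if j = k then 1 else 0) * S i k) =
      ∑ k, u i * ((N - 2) * (x k * S k i - x i * S k k)) := by
    intro i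
    rw [Finset.sum_comm]
    refine Finset.sum_congr rfl fun k _ => ?_
    rw [← Finset.mul_sum]
    simp only [Finset.sum_sub_distrib, Finset.sum_add_distrib, mul_ite, ite_mul, mul_one, mul_zero,
      zero_mul, Finset.sum_ite_eq', Finset.mem_univ, if_true, Finset.sum_const,
      Finset.card_univ, Fintype.card_fin, nsmul_eq_mul, hS i k]
    ring
  simp_rw [h1, Finset.sum_mul_sum, Finset.mul_sum, ← Finset.sum_sub_distrib, Finset.mul_sum]
  exact Finset.sum_congr rfl fun i _ => Finset.sum_congr rfl fun k _ => by ring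

/-- The Cauchy–Schwarz inequality between the trace and the Hilbert–Schmidt norm of the
compression of a symmetric matrix `S` to `x^⊥`, cleared of denominators. -/
lemma sq_trace_tangential_le (hS : ∀ i j, S i j = S j i) {p : Fin N → ℝ}
    (hp : ∀ i, ∑ k, x k * S k i = p i) {r c t h P : ℝ} (hr0 : 0 < r)
    (hr : ∑ i, x i ^ 2 = r) (hc : ∑ i, x i * p i = c) (ht : ∑ i, S i i = t)
    (hh : ∑ i, ∑ j, S i j ^ 2 = h) (hP : ∑ i, p i ^ 2 = P) :
    (r * t - c) ^ 2 ≤ (N - 1) * (r * (r * h - P) - (r * P - c ^ 2)) := by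
  -- `M / r ^ 2` is the compression of `S` to `x^⊥` and `Q / r` is the projection onto `x^⊥`.
  let M : Fin N → Fin N → ℝ := fun i j =>
    r ^ 2 * S i j - r * (x i * p j + p i * x j) + c * (x i * x j)
  let Q : Fin N → Fin N → ℝ := fun i j => r * (if i = j then 1 else 0) - x i * x j
  have hp' : ∀ i, ∑ k, x k * S i k = p i := fun i => by simp_rw [hS i, hp i]
  have hpx : ∑ i, p i * x i = c := by simp_rw [mul_comm (p _), hc]
  have hQQ : ∑ i, ∑ j, Q i j * Q i j = r ^ 2 * (N - 1) := by
    have : ∀ i j, Q i j * Q i j = (r ^ 2 - 2 * r * (x i * x j)) * (if i = j then 1 else 0)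
        + x i ^ 2 * x j ^ 2 := by
      intro i j; simp only [Q]; split_ifs <;> ring
    simp_rw [this, Finset.sum_add_distrib, ← Finset.mul_sum, ← Finset.sum_mul, hr]
    simp only [mul_ite, mul_one, mul_zero, Finset.sum_ite_eq, Finset.mem_univ, if_true,
      Finset.sum_sub_distrib, ← Finset.mul_sum, ← sq, hr, Finset.sum_const,
      Finset.card_univ, Fintype.card_fin, nsmul_eq_mul]
    ring
  have hMQ : ∑ i, ∑ j, M i j * Q i j = r ^ 2 * (r * t - c) := by
    have : ∀ i j, M i j * Q i j = r * M i j * (if i = j then 1 else 0)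
        + (-r ^ 2) * (x i * (x j * S i j)) + r * (x i ^ 2 * (x j * p j))
        + r * (x i * p i * x j ^ 2) + (-c) * (x i ^ 2 * x j ^ 2) := by
      intro i j; simp only [M, Q]; ring
    simp_rw [this, Finset.sum_add_distrib, ← Finset.mul_sum, ← Finset.sum_mul, hp', hc, hr]
    simp only [mul_ite, mul_one, mul_zero, Finset.sum_ite_eq, Finset.mem_univ, if_true, M]
    have : ∀ i, r * (r ^ 2 * S i i - r * (x i * p i + p i * x i) + c * (x i * x i)) =
        r ^ 3 * S i i + (-2 * r ^ 2) * (x i * p i) + (r * c) * x i ^ 2 := fun i => by ring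
    simp_rw [this, Finset.sum_add_distrib, ← Finset.mul_sum, hc, hr, ht]
    ring
  have hMM : ∑ i, ∑ j, M i j * M i j = r ^ 2 * (r * (r * h - P) - (r * P - c ^ 2)) := by
    have : ∀ i j, M i j * M i j = r ^ 4 * S i j ^ 2 + r ^ 2 * (x i ^ 2 * p j ^ 2)
        + r ^ 2 * (p i ^ 2 * x j ^ 2) + (2 * r ^ 2) * (x i * p i * (x j * p j))
        + c ^ 2 * (x i ^ 2 * x j ^ 2) + (-2 * r ^ 3) * (p j * (x i * S i j))
        + (-2 * r ^ 3) * (p i * (x j * S i j)) + (2 * r ^ 2 * c) * (x i * (x j * S i j))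
        + (-2 * r * c) * (x i ^ 2 * (x j * p j)) + (-2 * r * c) * (x i * p i * x j ^ 2) := by
      intro i j; simp only [M]; ring
    have e : ∑ i, ∑ j, p j * (x i * S i j) = P := by
      rw [Finset.sum_comm]
      simp_rw [← Finset.mul_sum, hp, ← sq, hP]
    simp_rw [this, Finset.sum_add_distrib, ← Finset.mul_sum, e,
      ← Finset.sum_mul, hp', hc, hr, hP, hh, ← sq, hP]
    ring
  have hcs : (∑ z : Fin N × Fin N, M z.1 z.2 * Q z.1 z.2) ^ 2 ≤
      (∑ z : Fin N × Fin N, M z.1 z.2 ^ 2) * ∑ z : Fin N × Fin N, Q z.1 z.2 ^ 2 :=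
    Finset.sum_mul_sq_le_sq_mul_sq _ _ _
  simp_rw [Fintype.sum_prod_type, sq (M _ _), sq (Q _ _), hMM, hMQ, hQQ] at hcs
  have h4 : 0 < r ^ 4 := by positivity
  refine le_of_mul_le_mul_left ?_ h4
  linarith

end Algebra

/-- A smooth closed one-form off the origin: the components of a real curl-free field. -/
structure ClosedForm {N : ℕ} (u : Fin N → Pt N → ℝ) : Prop where
  smooth : ∀ i, SmoothOff (u i)
  closed : ∀ x, x ≠ 0 → ∀ i j, partialD (u j) i x = partialD (u i) j x

section Forms

variable {N : ℕ} (u : Fin N → Pt N → ℝ)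

/-- `|u|²`. -/
def normSq (x : Pt N) : ℝ := ∑ i, u i x ^ 2

/-- `x · u`. -/
def radial (x : Pt N) : ℝ := ∑ i, x i * u i x

/-- The divergence of `u`. -/
def divg (x : Pt N) : ℝ := ∑ i, partialD (u i) i x

/-- `|∇u|²`. -/
def jacSq (x : Pt N) : ℝ := ∑ i, ∑ j, partialD (u j) i x ^ 2

/-- `x · Du`, where `D = x · ∇`. -/
def radialEuler (x : Pt N) : ℝ := ∑ i, x i * euler (u i) x

/-- `u · Du`. -/
def innerEuler (x : Pt N) : ℝ := ∑ i, u i x * euler (u i) x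

/-- `|Du|²`. -/
def eulerSq (x : Pt N) : ℝ := ∑ i, euler (u i) x ^ 2

/-- `r⁴` times the squared norm of the tangential block of the Jacobian of a closed form. -/
def tangSq (x : Pt N) : ℝ :=
  ‖x‖ ^ 2 * (‖x‖ ^ 2 * jacSq u x - eulerSq u x) - (‖x‖ ^ 2 * eulerSq u x - radialEuler u x ^ 2)

variable {u}

section Smooth

variable (hu : ∀ i, SmoothOff (u i))
include hu

lemma smoothOff_normSq : SmoothOff (normSq u) := by
  have := SmoothOff.sum (s := Finset.univ) fun i _ => (hu i).mul (hu i)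
  simpa only [← sq] using! this

lemma smoothOff_radial : SmoothOff (radial u) :=
  SmoothOff.sum fun i _ => (smoothOff_coord i).mul (hu i)

lemma smoothOff_jacSq : SmoothOff (jacSq u) := by
  have := SmoothOff.sum (s := Finset.univ) fun i _ => SmoothOff.sum (s := Finset.univ) fun j _ =>
    ((hu j).partialD i).mul ((hu j).partialD i)
  simpa only [← sq] using! this

lemma smoothOff_radialEuler : SmoothOff (radialEuler u) :=
  SmoothOff.sum fun i _ => (smoothOff_coord i).mul (hu i).euler

lemma smoothOff_innerEuler : SmoothOff (innerEuler u) :=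
  SmoothOff.sum fun i _ => (hu i).mul (hu i).euler

lemma smoothOff_eulerSq : SmoothOff (eulerSq u) := by
  have := SmoothOff.sum (s := Finset.univ) fun i _ => (hu i).euler.mul (hu i).euler
  simpa only [← sq] using! this

end Smooth

/-- With `L_ij = x_i ∂_j - x_j ∂_i`, the sum of `L_ij (u_i L_kj u_k) - L_kj (u_i L_ij u_k)` over
`i, j, k`: the second derivatives enter only through the commutators `[L_ij, L_kj]`, so that a
quadratic expression in `u` and its first derivatives remains. -/
lemma ClosedForm.null_commutator [NeZero N] (h : ClosedForm u) :
    Null fun x => (eulerSq u x - 2 * radialEuler u x * divg u x + ‖x‖ ^ 2 * divg u x ^ 2)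
      - (‖x‖ ^ 2 * jacSq u x - eulerSq u x)
      + (N - 2) * (innerEuler u x - radial u x * divg u x) := by
  have hs := h.smooth
  have hc := smoothOff_coord (N := N)
  have hS : ∀ i j, SmoothOff (partialD (u i) j) := fun i j => (hs i).partialD j
  have hW : ∀ a b c d : Fin N, SmoothOff fun x =>
      x a * partialD (u d) c x - x b * partialD (u d) a x := fun a b c d =>
    ((hc a).mul (hS d c)).sub ((hc b).mul (hS d a))
  have hsum := Null.sum (s := Finset.univ) fun j (_ : j ∈ Finset.univ) =>
    Null.sum (s := Finset.univ) fun i (_ : i ∈ Finset.univ) =>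
    Null.sum (s := Finset.univ) fun k (_ : k ∈ Finset.univ) =>
      (null_rotation ((hs i).mul (hW k j j k)) i j).add
        ((null_rotation ((hs i).mul (hW i j j k)) k j).const_mul (-1))
  refine hsum.congr fun x hx => ?_
  have hsym := h.closed x hx
  have key : ∀ i j k : Fin N,
    x i * partialD (fun x => u i x * (x k * partialD (u k) j x - x j * partialD (u k) k x)) j x
    - x j * partialD (fun x => u i x * (x k * partialD (u k) j x - x j * partialD (u k) k x)) i x
    + -1 * (x k *
        partialD (fun x => u i x * (x i * partialD (u k) j x - x j * partialD (u k) i x)) j x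
      - x j *
        partialD (fun x => u i x * (x i * partialD (u k) j x - x j * partialD (u k) i x)) k x) =
    ((x i * partialD (u i) j x - x j * partialD (u i) i x)
        * (x k * partialD (u k) j x - x j * partialD (u k) k x)
      - (x k * partialD (u i) j x - x j * partialD (u i) k x)
        * (x i * partialD (u k) j x - x j * partialD (u k) i x))
    + u i x * (x i * (if j = k then 1 else 0) * partialD (u k) j x
        - x k * (if j = i then 1 else 0) * partialD (u k) j x - x i * partialD (u k) k x
        + x j * (if j = i then 1 else 0) * partialD (u k) k x + x k * partialD (u k) i x
        - x j * (if j = k then 1 else 0) * partialD (u k) i x) := by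
    intro i j k
    have e : ∀ (m a b : Fin N) {G G' : Pt N → ℝ}, SmoothOff G → SmoothOff G' →
        partialD (fun x => u i x * (x a * G x - x b * G' x)) m x =
          partialD (u i) m x * (x a * G x - x b * G' x)
          + u i x * ((if m = a then 1 else 0) * G x + x a * partialD G m x
            - ((if m = b then 1 else 0) * G' x + x b * partialD G' m x)) := by
      intro m a b G G' hG hG'
      have ha := (hc a).differentiableAt hx
      have hb := (hc b).differentiableAt hx
      have hg := hG.differentiableAt hx
      have hg' := hG'.differentiableAt hx
      rw [partialD_mul ((hs i).differentiableAt hx) ((ha.fun_mul hg).fun_sub (hb.fun_mul hg')),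
        partialD_sub (ha.fun_mul hg) (hb.fun_mul hg'), partialD_mul ha hg, partialD_mul hb hg',
        partialD_coord, partialD_coord]
    rw [e _ _ _ (hS k j) (hS k k), e _ _ _ (hS k j) (hS k k), e _ _ _ (hS k j) (hS k i),
      e _ _ _ (hS k j) (hS k i), partialD_comm (hs k) hx j i, partialD_comm (hs k) hx j k,
      partialD_comm (hs k) hx k i]
    have d : ∀ a b : Fin N, (if a = b then (1 : ℝ) else 0) = if b = a then 1 else 0 := by
      simp [eq_comm]
    rw [d i k, d i j, d k j, if_pos rfl]
    ring
  simp_rw [key, Finset.sum_add_distrib]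
  have e1 := sum_rotation_minors x (S := fun i j => partialD (u j) i x) (fun i j => hsym i j)
  have e2 := sum_rotation_commutators x (fun i => u i x) (S := fun i j => partialD (u j) i x)
    (fun i j => hsym i j)
  rw [e1, e2, ← EuclideanSpace.real_norm_sq_eq]
  have e3 : ∑ j, ((∑ i, x i * partialD (u j) i x) - x j * ∑ i, partialD (u i) i x) ^ 2 =
      eulerSq u x - 2 * radialEuler u x * divg u x + ‖x‖ ^ 2 * divg u x ^ 2 := by
    rw [EuclideanSpace.real_norm_sq_eq, radialEuler, eulerSq, Finset.mul_sum, Finset.sum_mul,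
      Finset.sum_mul, ← Finset.sum_sub_distrib, ← Finset.sum_add_distrib]
    refine Finset.sum_congr rfl fun j _ => ?_
    rw [euler, divg]; ring
  rw [e3]
  rfl

lemma null_tangential_divergence [NeZero N] {g : Fin N → Pt N → ℝ} (hg : ∀ i, SmoothOff (g i)) :
    Null fun x => (N - 1) * radial g x + radialEuler g x - ‖x‖ ^ 2 * divg g x := by
  have hc := smoothOff_coord (N := N)
  have hsum := Null.sum (s := Finset.univ) fun i (_ : i ∈ Finset.univ) =>
    Null.sum (s := Finset.univ) fun k (_ : k ∈ Finset.univ) =>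
      null_rotation ((hc k).mul (hg i)) i k
  refine hsum.congr fun x hx => ?_
  have key : ∀ i : Fin N, ∑ k, (x i * partialD (fun x => x k * g i x) k x
      - x k * partialD (fun x => x k * g i x) i x) =
      (N - 1) * (x i * g i x) + x i * euler (g i) x - ‖x‖ ^ 2 * partialD (g i) i x := by
    intro i
    have e : ∀ k, x i * partialD (fun x => x k * g i x) k x
        - x k * partialD (fun x => x k * g i x) i x = x i * g i x
          - x k * (if i = k then 1 else 0) * g i x + x i * (x k * partialD (g i) k x)
          - x k ^ 2 * partialD (g i) i x := by
      intro k
      have h1 := (hc k).differentiableAt hx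
      have h2 := (hg i).differentiableAt hx
      rw [partialD_mul h1 h2, partialD_mul h1 h2, partialD_coord, partialD_coord, if_pos rfl]
      ring
    simp_rw [e, Finset.sum_sub_distrib, Finset.sum_add_distrib, Finset.sum_sub_distrib,
      ← Finset.mul_sum, ← Finset.sum_mul, ← EuclideanSpace.real_norm_sq_eq]
    simp only [mul_ite, mul_one, mul_zero, Finset.sum_ite_eq, Finset.mem_univ, if_true,
      Finset.sum_const, Finset.card_univ, Fintype.card_fin, nsmul_eq_mul, euler]
    ring
  simp_rw [key, Finset.sum_sub_distrib, Finset.sum_add_distrib, ← Finset.mul_sum]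
  rfl

lemma partialD_radial (hu : ∀ i, SmoothOff (u i)) {x : Pt N} (hx : x ≠ 0) (j : Fin N) :
    partialD (radial u) j x = u j x + ∑ i, x i * partialD (u i) j x := by
  have hc := fun i => (smoothOff_coord (N := N) i).differentiableAt hx
  have h1 := fun i => (hu i).differentiableAt hx
  have : partialD (radial u) j x = ∑ i, partialD (fun x => x i * u i x) j x :=
    partialD_sum (fun i _ => (hc i).fun_mul (h1 i)) j
  rw [this]
  simp_rw [fun i => partialD_mul (hc i) (h1 i) j, partialD_coord, Finset.sum_add_distrib]
  simp

lemma euler_radial (hu : ∀ i, SmoothOff (u i)) {x : Pt N} (hx : x ≠ 0) :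
    euler (radial u) x = radial u x + radialEuler u x := by
  simp_rw [euler, partialD_radial hu hx, mul_add, Finset.sum_add_distrib, radial, radialEuler,
    euler, Finset.mul_sum]
  congr 1
  rw [Finset.sum_comm]
  exact Finset.sum_congr rfl fun i _ => Finset.sum_congr rfl fun j _ => by ring

lemma euler_mul {F G : Pt N → ℝ} {x : Pt N} (hF : DifferentiableAt ℝ F x)
    (hG : DifferentiableAt ℝ G x) :
    euler (fun x => F x * G x) x = euler F x * G x + F x * euler G x := by
  simp_rw [euler, partialD_mul hF hG, Finset.sum_mul, Finset.mul_sum, ← Finset.sum_add_distrib]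
  exact Finset.sum_congr rfl fun i _ => by ring

lemma ClosedForm.partialD_radial (h : ClosedForm u) {x : Pt N} (hx : x ≠ 0) (j : Fin N) :
    partialD (radial u) j x = u j x + euler (u j) x := by
  rw [CKN.partialD_radial h.smooth hx, euler]
  simp_rw [h.closed x hx j]

/-- The tangential divergence of `(x · u) u`. -/
lemma ClosedForm.null_divergence [NeZero N] (h : ClosedForm u) :
    Null fun x => N * radial u x ^ 2 + 2 * radial u x * radialEuler u x
      - ‖x‖ ^ 2 * normSq u x - ‖x‖ ^ 2 * innerEuler u x
      - ‖x‖ ^ 2 * (radial u x * divg u x) := by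
  have hs := h.smooth
  have hr := smoothOff_radial hs
  refine (null_tangential_divergence fun i => hr.mul (hs i)).congr fun x hx => ?_
  have hr' := hr.differentiableAt hx
  have hs' := fun i => (hs i).differentiableAt hx
  have e1 : radial (fun i x => radial u x * u i x) x = radial u x ^ 2 := by
    rw [radial, sq, radial, Finset.mul_sum]
    exact Finset.sum_congr rfl fun i _ => by ring
  have e2 : radialEuler (fun i x => radial u x * u i x) x =
      (radial u x + radialEuler u x) * radial u x + radial u x * radialEuler u x := by
    rw [radialEuler]
    simp_rw [fun i => euler_mul hr' (hs' i), euler_radial hs hx, mul_add,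
      Finset.sum_add_distrib]
    congr 1
    · calc ∑ i, x i * ((radial u x + radialEuler u x) * u i x)
          = (radial u x + radialEuler u x) * ∑ i, x i * u i x := by
            rw [Finset.mul_sum]
            exact Finset.sum_congr rfl fun i _ => by ring
        _ = _ := rfl
    · rw [radialEuler, Finset.mul_sum]
      exact Finset.sum_congr rfl fun i _ => by ring
  have e3 : divg (fun i x => radial u x * u i x) x =
      normSq u x + innerEuler u x + radial u x * divg u x := by
    rw [divg]
    simp_rw [fun i => partialD_mul hr' (hs' i), h.partialD_radial hx, Finset.sum_add_distrib,
      divg, Finset.mul_sum, normSq, innerEuler, ← Finset.sum_add_distrib]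
    exact Finset.sum_congr rfl fun i _ => by ring
  rw [e1, e2, e3]
  ring

end Forms

/-! ### Wirtinger's inequality on circles -/

lemma wirtinger {g g' : ℝ → ℝ} (hg : ∀ θ, HasDerivAt g (g' θ) θ) (hg' : Continuous g')
    (hper : g (2 * Real.pi) = g 0) (hmean : ∫ θ in (0 : ℝ)..2 * Real.pi, g θ = 0) :
    0 ≤ ∫ θ in (0 : ℝ)..2 * Real.pi, (g' θ ^ 2 - g θ ^ 2) := by
  have hpi : (0 : ℝ) < 2 * Real.pi := by positivity
  have hgc : Continuous g := continuous_iff_continuousAt.2 fun θ => (hg θ).continuousAt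
  have hL2 : ∀ f : ℝ → ℝ, Continuous f → MemLp (fun θ => (f θ : ℂ)) 2
      (volume.restrict (Set.Ioc 0 (2 * Real.pi))) := by
    intro f hf
    have h1 : Continuous fun θ => (f θ : ℂ) := by fun_prop
    obtain ⟨B, hB⟩ := (isCompact_Icc (a := (0 : ℝ)) (b := 2 * Real.pi)).exists_bound_of_continuousOn
      h1.continuousOn
    exact MemLp.of_bound h1.aestronglyMeasurable B
      ((ae_restrict_iff' measurableSet_Ioc).2
        (Eventually.of_forall fun θ hθ => hB θ (Set.Ioc_subset_Icc_self hθ)))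
  have p1 := hasSum_sq_fourierCoeffOn hpi (hL2 g hgc)
  have p2 := hasSum_sq_fourierCoeffOn hpi (hL2 g' hg')
  have hle : ∀ n : ℤ, ‖fourierCoeffOn hpi (fun θ => (g θ : ℂ)) n‖ ^ 2 ≤
      ‖fourierCoeffOn hpi (fun θ => (g' θ : ℂ)) n‖ ^ 2 := by
    intro n
    by_cases hn : n = 0
    · subst hn
      have : fourierCoeffOn hpi (fun θ => (g θ : ℂ)) 0 = 0 := by
        rw [fourierCoeffOn_eq_integral]
        simp [intervalIntegral.integral_ofReal, hmean]
      rw [this]; simp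
    · have h1 := fourierCoeffOn_of_hasDerivAt hpi (f := fun θ => (g θ : ℂ))
        (f' := fun θ => (g' θ : ℂ)) hn (fun θ _ => (hg θ).ofReal_comp)
        ((Complex.continuous_ofReal.comp hg').intervalIntegrable _ _)
      rw [h1, hper]
      have hn1 : (1 : ℝ) ≤ |(n : ℝ)| := by exact_mod_cast Int.one_le_abs hn
      have : ‖(1 / (-2 * Real.pi * Complex.I * n) * (fourier (-n) ((0 : ℝ) : AddCircle (2 * Real.pi - 0)) *
          ((g 0 : ℂ) - g 0) - ((2 * Real.pi : ℝ) - (0 : ℝ)) * fourierCoeffOn hpi (fun θ => (g' θ : ℂ)) n) : ℂ)‖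
          = |(n : ℝ)|⁻¹ * ‖fourierCoeffOn hpi (fun θ => (g' θ : ℂ)) n‖ := by
        have hp : |Real.pi| = Real.pi := abs_of_pos Real.pi_pos
        simp [hp]
        field_simp
      rw [this]
      have h2 : |(n : ℝ)|⁻¹ ≤ 1 := inv_le_one_of_one_le₀ hn1
      gcongr
      exact mul_le_of_le_one_left (norm_nonneg _) h2
  have h3 := hasSum_le hle p1 p2
  simp only [sub_zero, smul_eq_mul, Complex.norm_real, Real.norm_eq_abs, sq_abs] at h3
  have h4 := le_of_mul_le_mul_left h3 (inv_pos.2 hpi)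
  have h5 := intervalIntegral.integral_sub (μ := volume) (a := 0) (b := 2 * Real.pi)
    (f := fun θ => g' θ ^ 2) (g := fun θ => g θ ^ 2)
    ((hg'.pow 2).intervalIntegrable _ _) ((hgc.pow 2).intervalIntegrable _ _)
  rw [h5]
  linarith

lemma fderiv_apply_eq_sum {N : ℕ} (F : Pt N → ℝ) (x v : Pt N) :
    fderiv ℝ F x v = ∑ j, v j * partialD F j x := by
  conv_lhs => rw [← (EuclideanSpace.basisFun (Fin N) ℝ).sum_repr v]
  simp [partialD]

/-- The quarter turn of the plane. -/
def quarterTurn (x : Pt 2) : Pt 2 := !₂[-x 1, x 0]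

/-- The rotation of the plane by the angle `θ`. -/
def rotation (θ : ℝ) : Pt 2 ≃ₗᵢ[ℝ] Pt 2 :=
  LinearIsometry.toLinearIsometryEquiv
    { toFun := fun x => Real.cos θ • x + Real.sin θ • quarterTurn x
      map_add' := fun x y => by
        ext i; fin_cases i <;> simp [quarterTurn] <;> ring
      map_smul' := fun c x => by
        ext i; fin_cases i <;> simp [quarterTurn] <;> ring
      norm_map' := fun x => by
        rw [EuclideanSpace.norm_eq, EuclideanSpace.norm_eq]
        congr 1
        simp [quarterTurn, Fin.sum_univ_two]
        linear_combination (x 0 ^ 2 + x 1 ^ 2) * Real.sin_sq_add_cos_sq θ } rfl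

lemma rotation_apply (θ : ℝ) (x : Pt 2) :
    rotation θ x = Real.cos θ • x + Real.sin θ • quarterTurn x := rfl

-- Unfolding the bundled isometry makes unification in the compositions below very slow.
attribute [irreducible] rotation

lemma hasDerivAt_rotation (θ : ℝ) (x : Pt 2) :
    HasDerivAt (fun θ => rotation θ x) (quarterTurn (rotation θ x)) θ := by
  simp_rw [rotation_apply]
  convert! ((Real.hasDerivAt_cos θ).smul_const x).add
    ((Real.hasDerivAt_sin θ).smul_const (quarterTurn x)) using 1
  ext i; fin_cases i <;> simp [quarterTurn]; ring

lemma continuous_rotation : Continuous fun z : ℝ × Pt 2 => rotation z.1 z.2 := by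
  simp_rw [rotation_apply]
  have : Continuous quarterTurn := by
    unfold quarterTurn
    refine (PiLp.continuous_toLp 2 _).comp (continuous_pi fun i => ?_)
    fin_cases i <;> simp <;> fun_prop
  have h2 : Continuous fun z : ℝ × Pt 2 => quarterTurn z.2 := this.comp continuous_snd
  fun_prop

/-- The angular derivative `x₀ ∂₁ - x₁ ∂₀` in the plane. -/
def angularD (F : Pt 2 → ℝ) (x : Pt 2) : ℝ := x 0 * partialD F 1 x - x 1 * partialD F 0 x

lemma hasDerivAt_comp_rotation {F : Pt 2 → ℝ} {θ : ℝ} {x : Pt 2}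
    (hF : DifferentiableAt ℝ F (rotation θ x)) :
    HasDerivAt (fun θ => F (rotation θ x)) (angularD F (rotation θ x)) θ := by
  have := hF.hasFDerivAt.comp_hasDerivAt θ (hasDerivAt_rotation θ x)
  rw [fderiv_apply_eq_sum] at this
  convert! this using 1
  simp [Fin.sum_univ_two, quarterTurn, angularD]
  ring

lemma rotation_ne_zero {x : Pt 2} (hx : x ≠ 0) (θ : ℝ) : rotation θ x ≠ 0 := by
  simpa using hx

lemma rotation_two_pi (x : Pt 2) : rotation (2 * Real.pi) x = rotation 0 x := by
  simp [rotation_apply]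

lemma SmoothOff.angularD {F : Pt 2 → ℝ} (hF : SmoothOff F) : SmoothOff (angularD F) :=
  ((smoothOff_coord 0).mul (hF.partialD 1)).sub ((smoothOff_coord 1).mul (hF.partialD 0))

lemma continuous_comp_rotation {F : Pt 2 → ℝ} (hF : ContinuousOn F {0}ᶜ) {x : Pt 2} (hx : x ≠ 0) :
    Continuous fun θ => F (rotation θ x) :=
  have h1 : Continuous fun θ : ℝ => (θ, x) := by fun_prop
  hF.comp_continuous (continuous_rotation.comp h1) fun θ => rotation_ne_zero hx θ

lemma RadialCutoff.comp_rotation {χ : Pt 2 → ℝ} (hχ : RadialCutoff χ) (θ : ℝ) (x : Pt 2) :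
    χ (rotation θ x) = χ x := by
  have h1 : ∀ θ, HasDerivAt (fun θ => χ (rotation θ x)) 0 θ := by
    intro θ
    have := hasDerivAt_comp_rotation (x := x) (θ := θ) (hχ.smooth.differentiable (by simp) _)
    rwa [angularD, hχ.radial, sub_self] at this
  have := is_const_of_deriv_eq_zero (fun θ => (h1 θ).differentiableAt) (fun θ => (h1 θ).deriv) θ 0
  simpa [rotation_apply] using this

/-- Averaging over the rotations: a function whose mean over every circle is nonnegative has
nonnegative integral against nonnegative radial cutoffs. -/
lemma integral_nonneg_of_circle_means {χ H : Pt 2 → ℝ} (hχ : RadialCutoff χ) (hχ0 : ∀ x, 0 ≤ χ x)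
    (hH : ContinuousOn H {0}ᶜ)
    (hmean : ∀ x, x ≠ 0 → 0 ≤ ∫ θ in (0 : ℝ)..2 * Real.pi, H (rotation θ x)) :
    0 ≤ ∫ x, χ x * H x := by
  have hpi : (0 : ℝ) ≤ 2 * Real.pi := by positivity
  have hcont := continuous_mul_of_tsupport hχ.smooth.continuous hχ.zero hH
  have hint := hχ.integrable_mul hH
  have hF : Integrable (fun z : ℝ × Pt 2 => χ (rotation z.1 z.2) * H (rotation z.1 z.2))
      ((volume.restrict (Set.Ioc 0 (2 * Real.pi))).prod volume) := by
    have hm : Continuous fun z : ℝ × Pt 2 => χ (rotation z.1 z.2) * H (rotation z.1 z.2) :=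
      hcont.comp continuous_rotation
    refine (integrable_prod_iff hm.aestronglyMeasurable).2 ⟨?_, ?_⟩
    · exact Eventually.of_forall fun θ =>
        (rotation θ).measurePreserving.integrable_comp_of_integrable hint
    · have : ∀ θ, ∫ x, ‖χ (rotation θ x) * H (rotation θ x)‖ = ∫ x, ‖χ x * H x‖ := fun θ =>
        (rotation θ).measurePreserving.integral_comp
          (rotation θ).toHomeomorph.measurableEmbedding (fun x => ‖χ x * H x‖)
      simp_rw [this]
      exact integrable_const _
  have e1 : ∫ θ in Set.Ioc 0 (2 * Real.pi), ∫ x, χ (rotation θ x) * H (rotation θ x) =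
      2 * Real.pi * ∫ x, χ x * H x := by
    have : ∀ θ, ∫ x, χ (rotation θ x) * H (rotation θ x) = ∫ x, χ x * H x := fun θ =>
      (rotation θ).measurePreserving.integral_comp
        (rotation θ).toHomeomorph.measurableEmbedding (fun x => χ x * H x)
    simp_rw [this]
    simp [hpi]
  have e2 := integral_integral_swap
    (f := fun θ x => χ (rotation θ x) * H (rotation θ x)) hF
  rw [e1] at e2
  have e3 : 0 ≤ ∫ x, ∫ θ in Set.Ioc 0 (2 * Real.pi), χ (rotation θ x) * H (rotation θ x) := by
    refine integral_nonneg fun x => ?_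
    simp_rw [hχ.comp_rotation, integral_const_mul]
    by_cases hx : x = 0
    · rw [hx, show χ 0 = 0 from image_eq_zero_of_notMem_tsupport hχ.zero]; simp
    · refine mul_nonneg (hχ0 x) ?_
      rw [← intervalIntegral.integral_of_le hpi]
      exact hmean x hx
  rw [← e2] at e3
  exact nonneg_of_mul_nonneg_right e3 (by positivity)

/-- Two functions related like the circulation density and the radial part of a closed form:
the mean of `G` over the circle of radius `r` does not depend on `r`. -/
lemma circle_mean_smul {G H : Pt 2 → ℝ} (hG : SmoothOff G) (hH : SmoothOff H)
    (h : ∀ x, x ≠ 0 → euler G x = angularD H x) {x : Pt 2} (hx : x ≠ 0) (σ : ℝ) :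
    ∫ θ in (0 : ℝ)..2 * Real.pi, G (rotation θ (Real.exp σ • x)) =
      ∫ θ in (0 : ℝ)..2 * Real.pi, G (rotation θ x) := by
  have hne : ∀ σ : ℝ, Real.exp σ • x ≠ 0 := fun σ => smul_ne_zero (Real.exp_ne_zero _) hx
  have hc : Continuous fun z : ℝ × ℝ => (z.1, Real.exp z.2 • x) := by fun_prop
  have hK : Continuous fun z : ℝ × ℝ => angularD H (rotation z.1 (Real.exp z.2 • x)) :=
    hH.angularD.continuousOn.comp_continuous (continuous_rotation.comp hc)
      fun z => rotation_ne_zero (hne _) _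
  have hd : ∀ θ τ : ℝ, HasDerivAt (fun τ => G (rotation θ (Real.exp τ • x)))
      (angularD H (rotation θ (Real.exp τ • x))) τ := by
    intro θ τ
    have hy := rotation_ne_zero (hne τ) θ
    have h1 : HasDerivAt (fun τ => rotation θ (Real.exp τ • x)) (rotation θ (Real.exp τ • x)) τ := by
      simp_rw [map_smul]
      exact (Real.hasDerivAt_exp τ).smul_const _
    have := (hG.differentiableAt hy).hasFDerivAt.comp_hasDerivAt τ h1
    rw [fderiv_apply_eq_sum] at this
    rw [← h _ hy]
    exact this
  have h0 : ∀ τ : ℝ, ∫ θ in (0 : ℝ)..2 * Real.pi, angularD H (rotation θ (Real.exp τ • x)) = 0 := by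
    intro τ
    rw [intervalIntegral.integral_eq_sub_of_hasDerivAt
      (fun θ _ => hasDerivAt_comp_rotation
        (hH.differentiableAt (rotation_ne_zero (hne τ) θ)))
      ((continuous_comp_rotation hH.angularD.continuousOn (hne τ)).intervalIntegrable _ _),
      rotation_two_pi, sub_self]
  have hdiff : ∀ θ : ℝ, G (rotation θ (Real.exp σ • x)) - G (rotation θ x) =
      ∫ τ in (0 : ℝ)..σ, angularD H (rotation θ (Real.exp τ • x)) := by
    intro θ
    rw [intervalIntegral.integral_eq_sub_of_hasDerivAt (fun τ _ => hd θ τ)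
      ((hK.comp (by fun_prop : Continuous fun τ : ℝ => (θ, τ))).intervalIntegrable _ _)]
    simp
  rw [← sub_eq_zero, ← intervalIntegral.integral_sub
    ((continuous_comp_rotation hG.continuousOn (hne σ)).intervalIntegrable _ _)
    ((continuous_comp_rotation hG.continuousOn hx).intervalIntegrable _ _)]
  simp_rw [hdiff]
  rw [intervalIntegral_intervalIntegral_swap]
  · simp_rw [h0]; simp
  · have hK' : Continuous
        (Function.uncurry fun θ τ => angularD H (rotation θ (Real.exp τ • x))) := hK
    exact (hK'.continuousOn.integrableOn_compact (isCompact_uIcc.prod isCompact_uIcc)).mono_set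
      (Set.prod_mono Set.uIoc_subset_uIcc Set.uIoc_subset_uIcc)

lemma circle_mean_eq_zero {G H : Pt 2 → ℝ} (hG : SmoothOff G) (hH : SmoothOff H)
    (h : ∀ x, x ≠ 0 → euler G x = angularD H x)
    (hsmall : ∀ ε : ℝ, 0 < ε → ∃ R : ℝ, 0 < R ∧ ∀ y, ‖y‖ = R → |G y| ≤ ε) {x : Pt 2} (hx : x ≠ 0) :
    ∫ θ in (0 : ℝ)..2 * Real.pi, G (rotation θ x) = 0 := by
  have hpi : (0 : ℝ) < 2 * Real.pi := by positivity
  have hxn : 0 < ‖x‖ := norm_pos_iff.2 hx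
  rw [← abs_eq_zero]
  refine le_antisymm (le_of_forall_pos_le_add fun ε hε => ?_) (abs_nonneg _)
  obtain ⟨R, hR, hb⟩ := hsmall (ε / (2 * Real.pi)) (by positivity)
  rw [← circle_mean_smul hG hH h hx (Real.log (R / ‖x‖)), Real.exp_log (by positivity)]
  have := intervalIntegral.norm_integral_le_of_norm_le_const (a := 0) (b := 2 * Real.pi)
    (f := fun θ => G (rotation θ ((R / ‖x‖) • x))) (C := ε / (2 * Real.pi)) (fun θ _ => hb _ (by
      rw [LinearIsometryEquiv.norm_map, norm_smul, Real.norm_eq_abs, abs_of_pos (by positivity),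
        div_mul_cancel₀ _ hxn.ne']))
  rw [sub_zero, abs_of_pos hpi, div_mul_cancel₀ _ hpi.ne', Real.norm_eq_abs] at this
  linarith

/-! ### The spherical inequality for closed forms -/

section Key

variable {N : ℕ} {u : Fin N → Pt N → ℝ}

lemma Null.norm_sq_mul {F : Pt N → ℝ} (hF : Null F) : Null fun x => ‖x‖ ^ 2 * F x := by
  refine ⟨(by fun_prop : ContinuousOn (fun x : Pt N => ‖x‖ ^ 2) {0}ᶜ).mul hF.continuousOn,
    fun χ hχ => ?_⟩
  rw [← hF.integral_eq_zero _ (hχ.norm_rpow_mul 2)]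
  exact integral_congr_ae (Eventually.of_forall fun x => by
    simp only [Real.rpow_ofNat]; ring)

lemma Null.integral_nonneg_of_le [NeZero N] {F G χ : Pt N → ℝ} (hF : Null F) (hχ : RadialCutoff χ)
    (hχ0 : ∀ x, 0 ≤ χ x) (hG : ContinuousOn G {0}ᶜ) (h : ∀ x, x ≠ 0 → F x ≤ G x) :
    0 ≤ ∫ x, χ x * G x := by
  rw [← hF.integral_eq_zero χ hχ]
  refine integral_mono_ae (hχ.integrable_mul hF.continuousOn) (hχ.integrable_mul hG) ?_
  filter_upwards [ae_ne_zero] with x hx using mul_le_mul_of_nonneg_left (h x hx) (hχ0 x)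

/-- In polar coordinates, with `T` and `P` the tangential parts of `u` and of `Du`, this is
`r²` times `|∇_σ u|² - (N - 1)|u|² - |P - T|² + (N + 1)|T|²`. -/
def sphereForm (u : Fin N → Pt N → ℝ) (x : Pt N) : ℝ :=
  tangSq u x + ‖x‖ ^ 2 * normSq u x + 2 * (‖x‖ ^ 2 * innerEuler u x - radial u x * radialEuler u x)
    - N * radial u x ^ 2

lemma continuousOn_sphereForm (hu : ∀ i, SmoothOff (u i)) : ContinuousOn (sphereForm u) {0}ᶜ := by
  have h1 := (smoothOff_normSq hu).continuousOn
  have h2 := (smoothOff_innerEuler hu).continuousOn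
  have h3 := (smoothOff_radial hu).continuousOn
  have h4 := (smoothOff_radialEuler hu).continuousOn
  have h5 := (smoothOff_jacSq hu).continuousOn
  have h6 := (smoothOff_eulerSq hu).continuousOn
  unfold sphereForm tangSq
  fun_prop

lemma ClosedForm.sq_le_tangSq (h : ClosedForm u) {x : Pt N} (hx : x ≠ 0) :
    (‖x‖ ^ 2 * divg u x - radialEuler u x) ^ 2 ≤ (N - 1) * tangSq u x :=
  sq_trace_tangential_le x (S := fun i j => partialD (u j) i x) (fun i j => h.closed x hx i j)
    (p := fun i => euler (u i) x) (fun _ => rfl) (by positivity)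
    (EuclideanSpace.real_norm_sq_eq x).symm rfl rfl rfl rfl

/-- For `N ≥ 3` the inequality holds up to divergences of tangential fields: this is the
argument of Lichnerowicz for the first eigenvalue of the sphere. -/
lemma ClosedForm.integral_sphereForm_nonneg_of_three_le [NeZero N] (hN : 3 ≤ N) (h : ClosedForm u)
    {χ : Pt N → ℝ} (hχ : RadialCutoff χ) (hχ0 : ∀ x, 0 ≤ χ x) :
    0 ≤ ∫ x, χ x * sphereForm u x := by
  have hN' : (0 : ℝ) < N - 2 := by
    have : (3 : ℝ) ≤ N := by exact_mod_cast hN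
    linarith
  have hnull := (h.null_commutator.norm_sq_mul.const_mul ((N - 2 : ℝ)⁻¹)).add
    (h.null_divergence.const_mul (-1))
  refine hnull.integral_nonneg_of_le hχ hχ0 (continuousOn_sphereForm h.smooth) fun x hx => ?_
  rw [← sub_nonneg]
  refine nonneg_of_mul_nonneg_right (a := (N - 2 : ℝ)) ?_ hN'
  have h1 := h.sq_le_tangSq hx
  rw [sphereForm]
  have h2 : (N - 2 : ℝ) * (N - 2 : ℝ)⁻¹ = 1 := mul_inv_cancel₀ hN'.ne'
  simp only [tangSq] at h1 ⊢
  linear_combination h1 + ‖x‖ ^ 2 * (eulerSq u x - 2 * radialEuler u x * divg u x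
    + ‖x‖ ^ 2 * divg u x ^ 2 - (‖x‖ ^ 2 * jacSq u x - eulerSq u x)
      + (N - 2) * (innerEuler u x - radial u x * divg u x)) * h2

/-- The angular component `x₀ u₁ - x₁ u₀` of a planar field. -/
def angular (u : Fin 2 → Pt 2 → ℝ) (x : Pt 2) : ℝ := x 0 * u 1 x - x 1 * u 0 x

lemma angularD_radial {u : Fin 2 → Pt 2 → ℝ} (h : ClosedForm u) {x : Pt 2} (hx : x ≠ 0) :
    euler (angular u) x = angularD (radial u) x := by
  have hc := fun i => (smoothOff_coord (N := 2) i).differentiableAt hx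
  have hs := fun i => (h.smooth i).differentiableAt hx
  rw [angularD, h.partialD_radial hx, h.partialD_radial hx]
  have : euler (angular u) x = ∑ j, x j * (partialD (fun x => x 0 * u 1 x) j x
      - partialD (fun x => x 1 * u 0 x) j x) :=
    Finset.sum_congr rfl fun j _ => by
      rw [← partialD_sub ((hc 0).fun_mul (hs 1)) ((hc 1).fun_mul (hs 0))]; rfl
  rw [this]
  simp_rw [partialD_mul (hc _) (hs _), partialD_coord]
  simp [Fin.sum_univ_two, euler]
  ring

/-- In the plane Wirtinger's inequality replaces the argument used for `N ≥ 3`; it needs the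
circulation of the closed form around the origin to vanish. -/
lemma ClosedForm.integral_sphereForm_nonneg_of_two {u : Fin 2 → Pt 2 → ℝ} (h : ClosedForm u)
    (hsmall : ∀ ε : ℝ, 0 < ε → ∃ R : ℝ, 0 < R ∧ ∀ y, ‖y‖ = R → |angular u y| ≤ ε)
    {χ : Pt 2 → ℝ} (hχ : RadialCutoff χ) (hχ0 : ∀ x, 0 ≤ χ x) :
    0 ≤ ∫ x, χ x * sphereForm u x := by
  have hs := h.smooth
  have hT : SmoothOff (angular u) :=
    ((smoothOff_coord 0).mul (hs 1)).sub ((smoothOff_coord 1).mul (hs 0))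
  have hTc : ContinuousOn (fun x => angularD (angular u) x ^ 2 - angular u x ^ 2) {0}ᶜ :=
    (hT.angularD.continuousOn.pow 2).sub (hT.continuousOn.pow 2)
  have hW : 0 ≤ ∫ x, χ x * (angularD (angular u) x ^ 2 - angular u x ^ 2) := by
    refine integral_nonneg_of_circle_means hχ hχ0 hTc fun x hx => ?_
    exact wirtinger
      (fun θ => hasDerivAt_comp_rotation (hT.differentiableAt (rotation_ne_zero hx θ)))
      (continuous_comp_rotation hT.angularD.continuousOn hx) (by rw [rotation_two_pi])
      (circle_mean_eq_zero hT (smoothOff_radial hs) (fun _ => angularD_radial h) hsmall hx)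
  have hnull := h.null_divergence.const_mul (-2)
  have key : ∀ x, x ≠ 0 → χ x * sphereForm u x =
      χ x * (angularD (angular u) x ^ 2 - angular u x ^ 2) +
      χ x * (-2 * (((2 : ℕ) : ℝ) * radial u x ^ 2 + 2 * radial u x * radialEuler u x
      - ‖x‖ ^ 2 * normSq u x - ‖x‖ ^ 2 * innerEuler u x
      - ‖x‖ ^ 2 * (radial u x * divg u x))) := by
    intro x hx
    have hc := fun i => (smoothOff_coord (N := 2) i).differentiableAt hx
    have hs := fun i => (h.smooth i).differentiableAt hx
    have e : ∀ j, partialD (angular u) j x = partialD (fun x => x 0 * u 1 x) j x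
        - partialD (fun x => x 1 * u 0 x) j x := fun j => by
      rw [← partialD_sub ((hc 0).fun_mul (hs 1)) ((hc 1).fun_mul (hs 0))]; rfl
    have hsym := h.closed x hx 0 1
    rw [angularD, e, e]
    simp_rw [partialD_mul (hc _) (hs _), partialD_coord]
    simp only [sphereForm, tangSq, jacSq, eulerSq, radialEuler, innerEuler, radial, divg, normSq,
      euler, angular, Fin.sum_univ_two, EuclideanSpace.real_norm_sq_eq, hsym]
    norm_num
    ring
  rw [integral_congr_off key, integral_add (hχ.integrable_mul hTc)
    (hχ.integrable_mul hnull.continuousOn), hnull.integral_eq_zero χ hχ, add_zero]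
  exact hW

lemma sq_angular_le {u : Fin 2 → Pt 2 → ℝ} (x : Pt 2) :
    angular u x ^ 2 ≤ ‖x‖ ^ 2 * normSq u x := by
  simp only [angular, normSq, EuclideanSpace.real_norm_sq_eq, Fin.sum_univ_two]
  nlinarith [sq_nonneg (x 0 * u 0 x + x 1 * u 1 x)]

/-- The decay of the field makes `x₀ u₁ - x₁ u₀` small on small circles or on large ones,
according to the sign of `s + 1`. -/
lemma exists_circle_angular_small {u : Fin 2 → Pt 2 → ℝ} {s : ℝ}
    (h0 : Tendsto (fun x => ‖x‖ ^ (-2 * s) * normSq u x) (𝓝[≠] 0) (𝓝 0))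
    (hinf : Tendsto (fun x => ‖x‖ ^ (-2 * s) * normSq u x) (Bornology.cobounded _) (𝓝 0))
    {ε : ℝ} (hε : 0 < ε) : ∃ R : ℝ, 0 < R ∧ ∀ y, ‖y‖ = R → |angular u y| ≤ ε := by
  -- On the circle of radius `R` one has `|angular u|² ≤ R^(2 + 2s) · o(1)`.
  have key : ∀ y : Pt 2, 0 < ‖y‖ → ‖y‖ ^ (2 + 2 * s) ≤ 1 →
      ‖y‖ ^ (-2 * s) * normSq u y < ε ^ 2 → |angular u y| ≤ ε := by
    intro y hy h1 h2
    refine abs_le_of_sq_le_sq ?_ hε.le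
    have h3 : ‖y‖ ^ 2 * normSq u y = ‖y‖ ^ (2 + 2 * s) * (‖y‖ ^ (-2 * s) * normSq u y) := by
      rw [← mul_assoc, ← Real.rpow_add hy]
      norm_num
    have hn : 0 ≤ normSq u y := Finset.sum_nonneg fun i _ => sq_nonneg _
    calc angular u y ^ 2 ≤ _ := sq_angular_le y
      _ = _ := h3
      _ ≤ 1 * (‖y‖ ^ (-2 * s) * normSq u y) := by gcongr
      _ ≤ ε ^ 2 := by linarith
  have he : ∀ᶠ z in 𝓝 (0 : ℝ), z < ε ^ 2 := eventually_lt_nhds (by positivity)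
  rcases le_total 0 (2 + 2 * s) with hs | hs
  · obtain ⟨δ, hδ, hb⟩ := Metric.eventually_nhds_iff.1
      (eventually_nhdsWithin_iff.1 (h0.eventually he))
    refine ⟨min (δ / 2) 1, by positivity, fun y hy => ?_⟩
    have hy0 : 0 < ‖y‖ := by rw [hy]; positivity
    refine key y hy0 (Real.rpow_le_one hy0.le (hy ▸ min_le_right _ _) hs) (hb ?_ (norm_pos_iff.1 hy0))
    rw [dist_zero_right, hy]
    exact (min_le_left _ _).trans_lt (by linarith)
  · rw [← comap_norm_atTop] at hinf
    obtain ⟨R, hR⟩ := eventually_atTop.1 (eventually_comap.1 (hinf.eventually he))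
    refine ⟨max R 1, by positivity, fun y hy => ?_⟩
    have hy1 : 1 ≤ ‖y‖ := hy ▸ le_max_right _ _
    exact key y (by linarith) (Real.rpow_le_one_of_one_le_of_nonpos hy1 hs)
      (hR ‖y‖ (hy ▸ le_max_left _ _) y rfl)

theorem ClosedForm.integral_sphereForm_nonneg [NeZero N] (hN : 2 ≤ N) (h : ClosedForm u) {s : ℝ}
    (h0 : Tendsto (fun x => ‖x‖ ^ (-2 * s) * normSq u x) (𝓝[≠] 0) (𝓝 0))
    (hinf : Tendsto (fun x => ‖x‖ ^ (-2 * s) * normSq u x) (Bornology.cobounded _) (𝓝 0))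
    {χ : Pt N → ℝ} (hχ : RadialCutoff χ) (hχ0 : ∀ x, 0 ≤ χ x) :
    0 ≤ ∫ x, χ x * sphereForm u x := by
  rcases hN.eq_or_lt with rfl | hN
  · exact h.integral_sphereForm_nonneg_of_two
      (fun _ => exists_circle_angular_small h0 hinf) hχ hχ0
  · exact h.integral_sphereForm_nonneg_of_three_le hN hχ hχ0

end Key

/-! ### The weighted inequality against cutoffs -/

section Weighted

variable {N : ℕ} {u : Fin N → Pt N → ℝ}

lemma euler_normSq (hu : ∀ i, SmoothOff (u i)) {x : Pt N} (hx : x ≠ 0) :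
    euler (normSq u) x = 2 * innerEuler u x := by
  have h1 := fun i => (hu i).differentiableAt hx
  have : normSq u = fun x => ∑ i, u i x * u i x := by ext x; simp [normSq, sq]
  simp_rw [euler, this, partialD_sum (fun i _ => (h1 i).fun_mul (h1 i)),
    partialD_mul (h1 _) (h1 _), innerEuler, euler, Finset.mul_sum]
  rw [Finset.sum_comm]
  exact Finset.sum_congr rfl fun i _ => Finset.sum_congr rfl fun j _ => by ring

lemma euler_norm_sq (x : Pt N) : euler (fun x : Pt N => ‖x‖ ^ 2) x = 2 * ‖x‖ ^ 2 := by
  have h : ∀ j, partialD (fun x : Pt N => ‖x‖ ^ 2) j x = 2 * x j := fun j => by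
    rw [partialD, (hasStrictFDerivAt_norm_sq x).hasFDerivAt.fderiv]
    simp [EuclideanSpace.inner_single_right]
  simp_rw [euler, h, EuclideanSpace.real_norm_sq_eq x, Finset.mul_sum]
  exact Finset.sum_congr rfl fun j _ => by ring

/-- `r²` times the squared norm of the tangential part of `u`. -/
def tangNormSq (u : Fin N → Pt N → ℝ) (x : Pt N) : ℝ := ‖x‖ ^ 2 * normSq u x - radial u x ^ 2

lemma smoothOff_tangNormSq (hu : ∀ i, SmoothOff (u i)) : SmoothOff (tangNormSq u) := by
  have h1 : SmoothOff fun x : Pt N => ‖x‖ ^ 2 := (contDiff_norm_sq ℝ).contDiffOn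
  simpa only [← sq] using! (h1.mul (smoothOff_normSq hu)).sub
    ((smoothOff_radial hu).mul (smoothOff_radial hu))

lemma euler_tangNormSq (hu : ∀ i, SmoothOff (u i)) {x : Pt N} (hx : x ≠ 0) :
    euler (tangNormSq u) x = 2 * (‖x‖ ^ 2 * normSq u x + ‖x‖ ^ 2 * innerEuler u x
      - radial u x ^ 2 - radial u x * radialEuler u x) := by
  have h1 : SmoothOff fun x : Pt N => ‖x‖ ^ 2 := (contDiff_norm_sq ℝ).contDiffOn
  have hn := (smoothOff_normSq hu).differentiableAt hx
  have hr := (smoothOff_radial hu).differentiableAt hx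
  have h2 := h1.differentiableAt hx
  have : euler (tangNormSq u) x = euler (fun x => ‖x‖ ^ 2 * normSq u x) x
      - euler (fun x => radial u x * radial u x) x := by
    simp_rw [euler, ← Finset.sum_sub_distrib, ← mul_sub]
    refine Finset.sum_congr rfl fun j _ => ?_
    rw [← partialD_sub (h2.fun_mul hn) (hr.fun_mul hr)]
    congr 2
    ext x; rw [tangNormSq, sq (radial u x)]
  rw [this, euler_mul h2 hn, euler_mul hr hr, euler_norm_sq, euler_normSq hu hx,
    euler_radial hu hx]
  ring

lemma sq_sum_mul_le_norm_sq (x : Pt N) (v : Fin N → ℝ) :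
    (∑ i, x i * v i) ^ 2 ≤ ‖x‖ ^ 2 * ∑ i, v i ^ 2 := by
  rw [EuclideanSpace.real_norm_sq_eq]
  exact Finset.sum_mul_sq_le_sq_mul_sq _ _ _

lemma normSq_nonneg (x : Pt N) : 0 ≤ normSq u x := Finset.sum_nonneg fun _ _ => sq_nonneg _

lemma tangNormSq_nonneg (x : Pt N) : 0 ≤ tangNormSq u x :=
  sub_nonneg.2 (sq_sum_mul_le_norm_sq x (u · x))

lemma tangNormSq_le (x : Pt N) : tangNormSq u x ≤ ‖x‖ ^ 2 * normSq u x :=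
  sub_le_self _ (sq_nonneg _)

/-- `|Du + k u|² ≥ 0`. -/
lemma eulerSq_add_nonneg (u : Fin N → Pt N → ℝ) (x : Pt N) (k : ℝ) :
    0 ≤ eulerSq u x + 2 * k * innerEuler u x + k ^ 2 * normSq u x := by
  have : eulerSq u x + 2 * k * innerEuler u x + k ^ 2 * normSq u x =
      ∑ i, (euler (u i) x + k * u i x) ^ 2 := by
    simp_rw [eulerSq, innerEuler, normSq, Finset.mul_sum, ← Finset.sum_add_distrib]
    exact Finset.sum_congr rfl fun i _ => by ring
  rw [this]
  exact Finset.sum_nonneg fun i _ => sq_nonneg _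

/-- The tangential part of `Du - s u` has nonnegative squared norm. -/
lemma tangential_euler_sub_nonneg (u : Fin N → Pt N → ℝ) (x : Pt N) (s : ℝ) :
    0 ≤ (‖x‖ ^ 2 * eulerSq u x - radialEuler u x ^ 2)
      - 2 * s * (‖x‖ ^ 2 * innerEuler u x - radial u x * radialEuler u x)
      + s ^ 2 * tangNormSq u x := by
  have h := sq_sum_mul_le_norm_sq x (fun i => euler (u i) x - s * u i x)
  have e1 : ∑ i, x i * (euler (u i) x - s * u i x) = radialEuler u x - s * radial u x := by
    simp_rw [radialEuler, radial, Finset.mul_sum, ← Finset.sum_sub_distrib]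
    exact Finset.sum_congr rfl fun i _ => by ring
  have e2 : ∑ i, (euler (u i) x - s * u i x) ^ 2 =
      eulerSq u x - 2 * s * innerEuler u x + s ^ 2 * normSq u x := by
    simp_rw [eulerSq, innerEuler, normSq, Finset.mul_sum, ← Finset.sum_sub_distrib,
      ← Finset.sum_add_distrib]
    exact Finset.sum_congr rfl fun i _ => by ring
  rw [e1, e2] at h
  rw [tangNormSq]
  linarith

/-- The integrand of the quadratic form `A + β² B - β (q + 2 (c - s)) M`. -/
def quadDensity (a q c s β : ℝ) (u : Fin N → Pt N → ℝ) (x : Pt N) : ℝ :=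
  ‖x‖ ^ (-2 * a - 2) * (‖x‖ ^ 2 * jacSq u x + β ^ 2 * (‖x‖ ^ q) ^ 2 * normSq u x
    - β * (q + 2 * (c - s)) * ‖x‖ ^ q * normSq u x)

/-- The boundary term produced by the radial integrations by parts. -/
def fluxDensity (a q c s β : ℝ) (u : Fin N → Pt N → ℝ) (x : Pt N) : ℝ :=
  (s - 1) * (‖x‖ ^ (-2 * a - 4) * tangNormSq u x) + c * (‖x‖ ^ (-2 * a - 2) * normSq u x)
    - β * (‖x‖ ^ (q - 2 * a - 2) * normSq u x)

lemma continuousOn_norm_rpow (m : ℝ) : ContinuousOn (fun x : Pt N => ‖x‖ ^ m) {0}ᶜ :=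
  (smoothOff_norm_rpow m).continuousOn

lemma continuousOn_quadDensity (hu : ∀ i, SmoothOff (u i)) (a q c s β : ℝ) :
    ContinuousOn (quadDensity a q c s β u) {0}ᶜ := by
  have h1 := (smoothOff_normSq hu).continuousOn
  have h5 := (smoothOff_jacSq hu).continuousOn
  have h6 := continuousOn_norm_rpow (N := N) q
  have h7 := continuousOn_norm_rpow (N := N) (-2 * a - 2)
  unfold quadDensity
  fun_prop

lemma continuousOn_fluxDensity (hu : ∀ i, SmoothOff (u i)) (a q c s β : ℝ) :
    ContinuousOn (fluxDensity a q c s β u) {0}ᶜ := by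
  have h1 := (smoothOff_normSq hu).continuousOn
  have h5 := (smoothOff_tangNormSq hu).continuousOn
  have h6 := continuousOn_norm_rpow (N := N) (q - 2 * a - 2)
  have h7 := continuousOn_norm_rpow (N := N) (-2 * a - 2)
  have h8 := continuousOn_norm_rpow (N := N) (-2 * a - 4)
  unfold fluxDensity
  fun_prop

/-- Completing squares: what remains of the quadratic form after the spherical inequality and
the exact radial derivatives have been split off is a sum of squares. -/
lemma quadDensity_ge {a q c s β : ℝ} (hs : (N : ℝ) + 1 ≤ (s - 1) ^ 2)
    (hc : c ^ 2 - 2 * c * s = N - 1) (hsa : 2 * s = 2 * a + 2 - N)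
    (hu : ∀ i, SmoothOff (u i)) {x : Pt N} (hx : x ≠ 0) :
    ‖x‖ ^ (-2 * a - 4) * sphereForm u x
      + (s - 1) * (‖x‖ ^ (-2 * a - 4) *
          (euler (tangNormSq u) x + ((-2 * a - 4) + N) * tangNormSq u x))
      + c * (‖x‖ ^ (-2 * a - 2) * (euler (normSq u) x + ((-2 * a - 2) + N) * normSq u x))
      + -β * (‖x‖ ^ (q - 2 * a - 2) *
          (euler (normSq u) x + ((q - 2 * a - 2) + N) * normSq u x)) ≤
      quadDensity a q c s β u x := by
  have hx0 : 0 < ‖x‖ := norm_pos_iff.2 hx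
  have e1 : ‖x‖ ^ (-2 * a - 2) = ‖x‖ ^ (-2 * a - 4) * ‖x‖ ^ 2 := by
    rw [← Real.rpow_natCast, ← Real.rpow_add hx0]; norm_num; congr 1; ring
  have e2 : ‖x‖ ^ (q - 2 * a - 2) = ‖x‖ ^ (-2 * a - 4) * ‖x‖ ^ 2 * ‖x‖ ^ q := by
    rw [← e1, ← Real.rpow_add hx0]; congr 1; ring
  rw [euler_tangNormSq hu hx, euler_normSq hu hx, quadDensity, e2, e1]
  have hw : 0 ≤ ‖x‖ ^ (-2 * a - 4) := by positivity
  generalize ‖x‖ ^ (-2 * a - 4) = w at hw ⊢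
  generalize ‖x‖ ^ q = z
  have k1 := tangential_euler_sub_nonneg u x s
  have k2 := mul_nonneg (sq_nonneg ‖x‖) (eulerSq_add_nonneg u x (-c + β * z))
  have k3 := mul_nonneg (sub_nonneg.2 hs) (tangNormSq_nonneg (u := u) x)
  have k := mul_nonneg hw (add_nonneg (add_nonneg k1 k2) k3)
  rw [← sub_nonneg]
  refine k.trans_eq ?_
  rw [sphereForm, tangSq, tangNormSq]
  have ha : a = s - 1 + N / 2 := by linarith
  subst ha
  linear_combination w * ‖x‖ ^ 2 * normSq u x * hc

lemma RadialCutoff.integrable_euler_mul {χ F : Pt N → ℝ} (hχ : RadialCutoff χ)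
    (hF : ContinuousOn F {0}ᶜ) : Integrable fun x => euler χ x * F x := by
  simp_rw [euler, Finset.sum_mul]
  refine integrable_finsetSum _ fun j _ => ?_
  have := hχ.integrable_partialD_mul ((smoothOff_coord j).continuousOn.mul hF) j
  exact this.congr (Eventually.of_forall fun x => by simp; ring)

lemma integral_linear_comb {f₀ f₁ f₂ f₃ : Pt N → ℝ} (h₀ : Integrable f₀) (h₁ : Integrable f₁)
    (h₂ : Integrable f₂) (h₃ : Integrable f₃) (c₁ c₂ c₃ : ℝ) :
    ∫ x, (f₀ x + c₁ * f₁ x + c₂ * f₂ x + c₃ * f₃ x) =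
      (∫ x, f₀ x) + c₁ * (∫ x, f₁ x) + c₂ * (∫ x, f₂ x) + c₃ * ∫ x, f₃ x := by
  have h₀₁ : Integrable fun x => f₀ x + c₁ * f₁ x := h₀.add (h₁.const_mul _)
  have h₀₂ : Integrable fun x => f₀ x + c₁ * f₁ x + c₂ * f₂ x := h₀₁.add (h₂.const_mul _)
  rw [integral_add h₀₂ (h₃.const_mul _), integral_add h₀₁ (h₂.const_mul _),
    integral_add h₀ (h₁.const_mul _), integral_const_mul, integral_const_mul, integral_const_mul]

theorem ClosedForm.integral_quadDensity_ge [NeZero N] (hN : 2 ≤ N) (h : ClosedForm u)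
    {a q c s β : ℝ} (hs : (N : ℝ) + 1 ≤ (s - 1) ^ 2)
    (hc : c ^ 2 - 2 * c * s = N - 1) (hsa : 2 * s = 2 * a + 2 - N)
    (h0 : Tendsto (fun x => ‖x‖ ^ (-2 * s) * normSq u x) (𝓝[≠] 0) (𝓝 0))
    (hinf : Tendsto (fun x => ‖x‖ ^ (-2 * s) * normSq u x) (Bornology.cobounded _) (𝓝 0))
    {χ : Pt N → ℝ} (hχ : RadialCutoff χ) (hχ0 : ∀ x, 0 ≤ χ x) :
    -∫ x, euler χ x * fluxDensity a q c s β u x ≤ ∫ x, χ x * quadDensity a q c s β u x := by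
  have hu := h.smooth
  have hn := smoothOff_normSq hu
  have ht := smoothOff_tangNormSq hu
  have hY : 0 ≤ ∫ x, χ x * (‖x‖ ^ (-2 * a - 4) * sphereForm u x) := by
    have := h.integral_sphereForm_nonneg hN h0 hinf (hχ.norm_rpow_mul (-2 * a - 4))
      fun x => mul_nonneg (by positivity) (hχ0 x)
    refine this.trans_eq (integral_congr_ae (Eventually.of_forall fun x => by ring))
  have iE : ∀ (m : ℝ) {F : Pt N → ℝ}, SmoothOff F →
      Integrable fun x => χ x * (‖x‖ ^ m * (euler F x + (m + N) * F x)) := fun m F hF =>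
    hχ.integrable_mul ((continuousOn_norm_rpow m).mul
      (hF.euler.continuousOn.add (continuousOn_const.mul hF.continuousOn)))
  have iY : Integrable fun x => χ x * (‖x‖ ^ (-2 * a - 4) * sphereForm u x) :=
    hχ.integrable_mul ((continuousOn_norm_rpow _).mul (continuousOn_sphereForm hu))
  have iF : ∀ (m : ℝ) {F : Pt N → ℝ}, SmoothOff F →
      Integrable fun x => euler χ x * (‖x‖ ^ m * F x) := fun m F hF =>
    hχ.integrable_euler_mul ((continuousOn_norm_rpow m).mul hF.continuousOn)
  have hle : ∫ x, (χ x * (‖x‖ ^ (-2 * a - 4) * sphereForm u x)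
      + (s - 1) * (χ x * (‖x‖ ^ (-2 * a - 4) *
          (euler (tangNormSq u) x + ((-2 * a - 4) + N) * tangNormSq u x)))
      + c * (χ x * (‖x‖ ^ (-2 * a - 2) * (euler (normSq u) x + ((-2 * a - 2) + N) * normSq u x)))
      + -β * (χ x * (‖x‖ ^ (q - 2 * a - 2) *
          (euler (normSq u) x + ((q - 2 * a - 2) + N) * normSq u x)))) ≤
      ∫ x, χ x * quadDensity a q c s β u x := by
    refine integral_mono_ae (((iY.add ((iE _ ht).const_mul _)).add ((iE _ hn).const_mul _)).add
      ((iE _ hn).const_mul _)) (hχ.integrable_mul (continuousOn_quadDensity hu a q c s β)) ?_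
    filter_upwards [ae_ne_zero] with x hx
    have := mul_le_mul_of_nonneg_left (quadDensity_ge (q := q) (β := β) hs hc hsa hu hx) (hχ0 x)
    refine le_of_eq_of_le ?_ this
    ring
  have hflux : ∫ x, euler χ x * fluxDensity a q c s β u x =
      (s - 1) * (∫ x, euler χ x * (‖x‖ ^ (-2 * a - 4) * tangNormSq u x))
      + c * (∫ x, euler χ x * (‖x‖ ^ (-2 * a - 2) * normSq u x))
      + -β * ∫ x, euler χ x * (‖x‖ ^ (q - 2 * a - 2) * normSq u x) := by
    have h0 : Integrable fun _ : Pt N => (0 : ℝ) := integrable_zero _ _ _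
    have := integral_linear_comb h0 (iF (-2 * a - 4) ht) (iF (-2 * a - 2) hn)
      (iF (q - 2 * a - 2) hn) (s - 1) c (-β)
    rw [integral_zero, zero_add] at this
    rw [← this]
    refine integral_congr_ae (Eventually.of_forall fun x => ?_)
    simp only [fluxDensity]; ring
  have hsplit := integral_linear_comb iY (iE (-2 * a - 4) ht) (iE (-2 * a - 2) hn)
    (iE (q - 2 * a - 2) hn) (s - 1) c (-β)
  rw [hsplit, hχ.integral_euler ht, hχ.integral_euler hn, hχ.integral_euler hn] at hle
  rw [hflux]
  linarith

end Weighted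

/-! ### Removing the cutoff -/

section Limit

variable {N : ℕ}

/-- A radial function that vanishes on the unit ball and equals `1` for `|x|² ≥ 2`. -/
def outerStep (x : Pt N) : ℝ := Real.smoothTransition (‖x‖ ^ 2 - 1)

lemma contDiff_outerStep : ContDiff ℝ ∞ (outerStep (N := N)) :=
  Real.smoothTransition.contDiff.comp ((contDiff_norm_sq ℝ).sub contDiff_const)

lemma outerStep_eq_zero {x : Pt N} (hx : ‖x‖ ≤ 1) : outerStep x = 0 :=
  Real.smoothTransition.zero_of_nonpos (by nlinarith [norm_nonneg x])

lemma outerStep_eq_one {x : Pt N} (hx : 2 ≤ ‖x‖) : outerStep x = 1 :=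
  Real.smoothTransition.one_of_one_le (by nlinarith)

lemma outerStep_mono {x y : Pt N} (h : ‖x‖ ≤ ‖y‖) : outerStep x ≤ outerStep y :=
  Real.smoothTransition.monotone (by gcongr)

lemma partialD_outerStep_smul (r : ℝ) (x : Pt N) (j : Fin N) :
    partialD (fun x => outerStep (r • x)) j x =
      2 * r ^ 2 * deriv Real.smoothTransition (‖r • x‖ ^ 2 - 1) * x j := by
  have h1 : HasFDerivAt (fun x : Pt N => r ^ 2 * ‖x‖ ^ 2 - 1) (r ^ 2 • (2 • innerSL ℝ x)) x :=
    (((hasStrictFDerivAt_norm_sq x).hasFDerivAt).const_mul (r ^ 2)).sub_const 1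
  have e : ∀ x : Pt N, ‖r • x‖ ^ 2 - 1 = r ^ 2 * ‖x‖ ^ 2 - 1 := fun x => by
    rw [norm_smul, mul_pow, Real.norm_eq_abs, sq_abs]
  have h2 : HasDerivAt Real.smoothTransition
      (deriv Real.smoothTransition (r ^ 2 * ‖x‖ ^ 2 - 1)) (r ^ 2 * ‖x‖ ^ 2 - 1) :=
    ((Real.smoothTransition.contDiff (n := 1)).differentiable (by simp) _).hasDerivAt
  have h3 : HasFDerivAt (fun x : Pt N => outerStep (r • x))
      (deriv Real.smoothTransition (r ^ 2 * ‖x‖ ^ 2 - 1) • (r ^ 2 • (2 • innerSL ℝ x))) x := by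
    simp_rw [outerStep, e]
    exact h2.comp_hasFDerivAt x h1
  rw [partialD, h3.fderiv, e]
  simp [EuclideanSpace.inner_single_right]
  ring

/-- The Euler derivative of `outerStep`, which is supported in `1 ≤ |x| ≤ 2`. -/
def stepFlux (x : Pt N) : ℝ := 2 * deriv Real.smoothTransition (‖x‖ ^ 2 - 1) * ‖x‖ ^ 2

lemma euler_outerStep_smul (r : ℝ) (x : Pt N) :
    euler (fun x => outerStep (r • x)) x = stepFlux (r • x) := by
  simp_rw [euler, partialD_outerStep_smul, stepFlux]
  rw [norm_smul r x, mul_pow, EuclideanSpace.real_norm_sq_eq x, Real.norm_eq_abs, sq_abs,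
    Finset.mul_sum, Finset.mul_sum]
  exact Finset.sum_congr rfl fun j _ => by ring

lemma continuous_stepFlux : Continuous (stepFlux (N := N)) := by
  have : Continuous (deriv Real.smoothTransition) :=
    (Real.smoothTransition.contDiff (n := 1)).continuous_deriv le_rfl
  unfold stepFlux
  fun_prop

lemma stepFlux_eq_zero {x : Pt N} (hx : ‖x‖ < 1 ∨ 2 < ‖x‖) : stepFlux x = 0 := by
  have : deriv Real.smoothTransition (‖x‖ ^ 2 - 1) = 0 := by
    rcases hx with hx | hx
    · have h : Real.smoothTransition =ᶠ[𝓝 (‖x‖ ^ 2 - 1)] fun _ => 0 := by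
        filter_upwards [Iio_mem_nhds (show ‖x‖ ^ 2 - 1 < 0 by nlinarith [norm_nonneg x])] with y hy
        exact Real.smoothTransition.zero_of_nonpos (le_of_lt hy)
      rw [h.deriv_eq, deriv_const]
    · have h : Real.smoothTransition =ᶠ[𝓝 (‖x‖ ^ 2 - 1)] fun _ => 1 := by
        filter_upwards [Ioi_mem_nhds (show 1 < ‖x‖ ^ 2 - 1 by nlinarith)] with y hy
        exact Real.smoothTransition.one_of_one_le (le_of_lt hy)
      rw [h.deriv_eq, deriv_const]
  rw [stepFlux, this]; ring

lemma hasCompactSupport_stepFlux : HasCompactSupport (stepFlux (N := N)) :=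
  HasCompactSupport.intro (isCompact_closedBall (0 : Pt N) 2) fun x hx =>
    stepFlux_eq_zero (Or.inr (by simpa using hx))

lemma zero_notMem_tsupport_stepFlux : (0 : Pt N) ∉ tsupport (stepFlux (N := N)) := by
  rw [notMem_tsupport_iff_eventuallyEq]
  filter_upwards [Metric.ball_mem_nhds (0 : Pt N) one_pos] with x hx
  exact stepFlux_eq_zero (Or.inl (by simpa using hx))

/-- Radial cutoffs equal to `1` for `2 / r ≤ |x| ≤ r`. -/
def annulus (r : ℝ) (x : Pt N) : ℝ := outerStep (r • x) - outerStep (r⁻¹ • x)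

lemma contDiff_outerStep_smul (r : ℝ) : ContDiff ℝ ∞ fun x : Pt N => outerStep (r • x) :=
  contDiff_outerStep.comp (contDiff_const_smul r)

lemma radialCutoff_annulus {r : ℝ} (hr : 1 ≤ r) : RadialCutoff (annulus r : Pt N → ℝ) := by
  have hr0 : 0 < r := by linarith
  have hd := fun (t : ℝ) (x : Pt N) => (contDiff_outerStep_smul (N := N) t).differentiable (by simp) x
  refine ⟨(contDiff_outerStep_smul r).sub (contDiff_outerStep_smul r⁻¹),
    HasCompactSupport.intro (isCompact_closedBall (0 : Pt N) (2 * r)) fun x hx => ?_, ?_,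
    fun x i j => ?_⟩
  · have hx : 2 * r < ‖x‖ := by simpa using hx
    rw [annulus, outerStep_eq_one, outerStep_eq_one, sub_self]
    · rw [norm_smul, Real.norm_eq_abs, abs_of_pos (by positivity), le_inv_mul_iff₀ hr0]; linarith
    · rw [norm_smul, Real.norm_eq_abs, abs_of_pos hr0]; nlinarith
  · rw [notMem_tsupport_iff_eventuallyEq]
    filter_upwards [Metric.ball_mem_nhds (0 : Pt N) (inv_pos.2 hr0)] with x hx
    have hx : ‖x‖ < r⁻¹ := by simpa using hx
    have h1 : r⁻¹ ≤ 1 := inv_le_one_of_one_le₀ hr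
    rw [annulus, outerStep_eq_zero, outerStep_eq_zero]
    · simp
    · rw [norm_smul, Real.norm_eq_abs, abs_of_pos (by positivity)]
      nlinarith [norm_nonneg x, inv_pos.2 hr0]
    · rw [norm_smul, Real.norm_eq_abs, abs_of_pos hr0]
      calc r * ‖x‖ ≤ r * r⁻¹ := by gcongr
        _ = 1 := mul_inv_cancel₀ hr0.ne'
  · have : ∀ j, partialD (annulus r) j x = partialD (fun x => outerStep (r • x)) j x
        - partialD (fun x => outerStep (r⁻¹ • x)) j x := fun j =>
      partialD_sub (hd r x) (hd r⁻¹ x) j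
    rw [this, this]
    simp_rw [partialD_outerStep_smul]
    ring

lemma euler_annulus (r : ℝ) (x : Pt N) :
    euler (annulus r) x = stepFlux (r • x) - stepFlux (r⁻¹ • x) := by
  have hd := fun (t : ℝ) => (contDiff_outerStep_smul (N := N) t).differentiable (by simp) x
  rw [← euler_outerStep_smul, ← euler_outerStep_smul]
  simp_rw [euler, ← Finset.sum_sub_distrib, ← mul_sub]
  exact Finset.sum_congr rfl fun j _ => by rw [← partialD_sub (hd r) (hd r⁻¹)]; rfl

lemma annulus_nonneg {r : ℝ} (hr : 1 ≤ r) (x : Pt N) : 0 ≤ annulus r x := by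
  have hr0 : 0 < r := by linarith
  refine sub_nonneg.2 (outerStep_mono ?_)
  rw [norm_smul, norm_smul, Real.norm_eq_abs, Real.norm_eq_abs, abs_of_pos hr0,
    abs_of_pos (inv_pos.2 hr0)]
  have h1 : r⁻¹ ≤ 1 := inv_le_one_of_one_le₀ hr
  gcongr
  linarith

lemma annulus_le_one (r : ℝ) (x : Pt N) : annulus r x ≤ 1 := by
  have h1 : outerStep (r • x) ≤ 1 := Real.smoothTransition.le_one _
  have h2 : 0 ≤ outerStep (r⁻¹ • x) := Real.smoothTransition.nonneg _
  rw [annulus]; linarith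

lemma tendsto_annulus {x : Pt N} (hx : x ≠ 0) : Tendsto (fun r => annulus r x) atTop (𝓝 1) := by
  have hx0 : 0 < ‖x‖ := norm_pos_iff.2 hx
  refine tendsto_const_nhds.congr' ?_
  filter_upwards [eventually_ge_atTop (2 / ‖x‖), eventually_ge_atTop ‖x‖, eventually_gt_atTop 0]
    with r h1 h2 hr
  rw [annulus, outerStep_eq_one, outerStep_eq_zero, sub_zero]
  · rw [norm_smul, Real.norm_eq_abs, abs_of_pos (inv_pos.2 hr), inv_mul_le_iff₀ hr]; linarith
  · rw [norm_smul, Real.norm_eq_abs, abs_of_pos hr]; exact (div_le_iff₀ hx0).1 h1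

/-- Scale invariance of `|x|^{-N} dx`: the flux of `G` through the dilated step is controlled by
the size of `|x|^N G` on a dilated annulus. -/
lemma abs_integral_stepFlux_smul_le [NeZero N] {G : Pt N → ℝ} {r ε : ℝ} (hr : 0 < r)
    (hG : ∀ y : Pt N, 1 ≤ ‖y‖ → ‖y‖ ≤ 2 → |‖r⁻¹ • y‖ ^ N * G (r⁻¹ • y)| ≤ ε) :
    |∫ x, stepFlux (r • x) * G x| ≤ ε * ∫ y : Pt N, |stepFlux y| * ‖y‖ ^ (-N : ℝ) := by
  have h1 : ∫ x, stepFlux (r • x) * G x =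
      ∫ y : Pt N, stepFlux y * ‖y‖ ^ (-N : ℝ) * (‖r⁻¹ • y‖ ^ N * G (r⁻¹ • y)) := by
    have := Measure.integral_comp_smul volume (fun y : Pt N => stepFlux y * G (r⁻¹ • y)) r
    simp only [inv_smul_smul₀ hr.ne'] at this
    rw [this, ← integral_smul]
    refine integral_congr_off fun y hy => ?_
    have hy0 : 0 < ‖y‖ := norm_pos_iff.2 hy
    simp only [finrank_euclideanSpace, Fintype.card_fin, smul_eq_mul, norm_smul, norm_inv,
      Real.norm_eq_abs, abs_inv, abs_pow, abs_of_pos hr, mul_pow, Real.rpow_neg hy0.le,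
      Real.rpow_natCast, inv_pow]
    have hyN : ‖y‖ ^ N ≠ 0 := by positivity
    linear_combination -((r ^ N)⁻¹ * stepFlux y * G (r⁻¹ • y)) * inv_mul_cancel₀ hyN
  have hint : Integrable fun y : Pt N => |stepFlux y| * ‖y‖ ^ (-N : ℝ) := by
    have := (integrable_mul_of_tsupport continuous_stepFlux hasCompactSupport_stepFlux
      zero_notMem_tsupport_stepFlux (continuousOn_norm_rpow (N := N) (-N))).abs
    refine this.congr (Eventually.of_forall fun y => ?_)
    simp only [abs_mul]
    rw [abs_of_nonneg (by positivity : 0 ≤ ‖y‖ ^ (-N : ℝ))]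
  rw [h1, ← integral_const_mul, ← Real.norm_eq_abs]
  refine norm_integral_le_of_norm_le (hint.const_mul ε) (Eventually.of_forall fun y => ?_)
  have hp : 0 ≤ ‖y‖ ^ (-N : ℝ) := by positivity
  rw [Real.norm_eq_abs, abs_mul, abs_mul, abs_of_nonneg hp, mul_comm ε]
  by_cases hy : ‖y‖ < 1 ∨ 2 < ‖y‖
  · rw [stepFlux_eq_zero hy]; simp
  · push Not at hy
    exact mul_le_mul_of_nonneg_left (hG y hy.1 hy.2) (by positivity)

/-- The flux terms disappear in the limit when `|x|^N G` tends to zero at both ends. -/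
lemma tendsto_integral_stepFlux_smul [NeZero N] {G : Pt N → ℝ} {ι : Type*} {L : Filter ι}
    {r : ι → ℝ} {l : Filter (Pt N)} (hr : ∀ᶠ n in L, 0 < r n)
    (hl : ∀ S ∈ l, ∀ᶠ n in L, ∀ y : Pt N, 1 ≤ ‖y‖ → ‖y‖ ≤ 2 → (r n)⁻¹ • y ∈ S)
    (hG : Tendsto (fun x => ‖x‖ ^ N * G x) l (𝓝 0)) :
    Tendsto (fun n => ∫ x, stepFlux (r n • x) * G x) L (𝓝 0) := by
  set K := ∫ y : Pt N, |stepFlux y| * ‖y‖ ^ (-N : ℝ) with hK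
  have hK0 : 0 ≤ K := integral_nonneg fun y => by positivity
  rw [Metric.tendsto_nhds]
  intro ε hε
  have hε' : 0 < ε / (K + 1) := by positivity
  have hS := (Metric.tendsto_nhds.1 hG) _ hε'
  filter_upwards [hr, hl _ hS] with n hn hy
  rw [dist_zero_right, Real.norm_eq_abs]
  refine (abs_integral_stepFlux_smul_le (G := G) (ε := ε / (K + 1)) hn fun y h1 h2 => ?_).trans_lt ?_
  · have := hy y h1 h2
    simp only [dist_zero_right, Real.norm_eq_abs] at this
    exact this.le
  · rw [← hK, div_mul_eq_mul_div, div_lt_iff₀ (by positivity)]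
    nlinarith

theorem integral_nonneg_of_cutoff [NeZero N] {Ψ G : Pt N → ℝ} (hΨ : Integrable Ψ)
    (hGc : ContinuousOn G {0}ᶜ)
    (hG0 : Tendsto (fun x => ‖x‖ ^ N * G x) (𝓝[≠] 0) (𝓝 0))
    (hGinf : Tendsto (fun x => ‖x‖ ^ N * G x) (Bornology.cobounded _) (𝓝 0))
    (h : ∀ χ : Pt N → ℝ, RadialCutoff χ → (∀ x, 0 ≤ χ x) →
      -∫ x, euler χ x * G x ≤ ∫ x, χ x * Ψ x) : 0 ≤ ∫ x, Ψ x := by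
  have t1 : Tendsto (fun r : ℝ => ∫ x, annulus r x * Ψ x) atTop (𝓝 (∫ x, Ψ x)) := by
    refine tendsto_integral_filter_of_dominated_convergence (fun x => ‖Ψ x‖) ?_ ?_ hΨ.norm ?_
    · filter_upwards [eventually_ge_atTop 1] with r hr
      exact (radialCutoff_annulus hr).smooth.continuous.aestronglyMeasurable.mul
        hΨ.aestronglyMeasurable
    · filter_upwards [eventually_ge_atTop 1] with r hr
      refine Eventually.of_forall fun x => ?_
      rw [norm_mul, Real.norm_eq_abs, abs_of_nonneg (annulus_nonneg hr x)]
      exact mul_le_of_le_one_left (norm_nonneg _) (annulus_le_one r x)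
    · filter_upwards [ae_ne_zero] with x hx
      simpa using (tendsto_annulus hx).mul_const (Ψ x)
  have t2 : Tendsto (fun r : ℝ => ∫ x, stepFlux (r • x) * G x) atTop (𝓝 0) := by
    refine tendsto_integral_stepFlux_smul (eventually_gt_atTop 0) (fun S hS => ?_) hG0
    obtain ⟨δ, hδ, hb⟩ := Metric.mem_nhdsWithin_iff.1 hS
    filter_upwards [eventually_gt_atTop (2 / δ), eventually_gt_atTop 0] with r hr hr0 y h1 h2
    have hy0 : y ≠ 0 := norm_pos_iff.1 (by linarith)
    refine hb ⟨?_, smul_ne_zero (inv_ne_zero hr0.ne') hy0⟩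
    rw [mem_ball_zero_iff, norm_smul, norm_inv, Real.norm_eq_abs, abs_of_pos hr0,
      inv_mul_lt_iff₀ hr0]
    rw [div_lt_iff₀ hδ] at hr
    linarith
  have t3 : Tendsto (fun r : ℝ => ∫ x, stepFlux (r⁻¹ • x) * G x) atTop (𝓝 0) := by
    refine tendsto_integral_stepFlux_smul
      ((eventually_gt_atTop (0 : ℝ)).mono fun r hr => inv_pos.2 hr) (fun S hS => ?_) hGinf
    rw [← comap_norm_atTop] at hS
    obtain ⟨T, hT, hb⟩ := hS
    obtain ⟨R, hR⟩ := mem_atTop_sets.1 hT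
    filter_upwards [eventually_ge_atTop R, eventually_gt_atTop 0] with r hr hr0 y h1 h2
    refine hb (hR _ ?_)
    rw [inv_inv, norm_smul, Real.norm_eq_abs, abs_of_pos hr0]
    nlinarith
  have t4 := (t2.sub t3).neg
  rw [sub_zero, neg_zero] at t4
  refine le_of_tendsto_of_tendsto t4 t1 ?_
  have hi : ∀ r : ℝ, 0 < r → Integrable fun x : Pt N => stepFlux (r • x) * G x := by
    intro r hr
    have := (integrable_mul_of_tsupport continuous_stepFlux hasCompactSupport_stepFlux
      zero_notMem_tsupport_stepFlux (F := fun y : Pt N => G (r⁻¹ • y))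
      (hGc.comp (by fun_prop) fun y hy => smul_ne_zero (inv_ne_zero hr.ne') hy)).comp_smul hr.ne'
    simpa only [inv_smul_smul₀ hr.ne'] using this
  filter_upwards [eventually_ge_atTop 1] with r hr
  have hr0 : 0 < r := by linarith
  refine le_of_eq_of_le ?_ (h _ (radialCutoff_annulus hr) (annulus_nonneg hr))
  rw [← integral_sub (hi r hr0) (hi r⁻¹ (inv_pos.2 hr0))]
  simp_rw [euler_annulus, sub_mul]

end Limit

/-! ### The inequality for curl-free fields -/

section Fields

variable {𝕜 : Type*} [RCLike 𝕜] {N : ℕ} {U : Field 𝕜 N}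

/-- The components of a field composed with a real-linear functional, such as the real or the
imaginary part. -/
def component (ℓ : 𝕜 →L[ℝ] ℝ) (U : Field 𝕜 N) (i : Fin N) (x : Pt N) : ℝ := ℓ (U x i)

lemma hasFDerivAt_component (ℓ : 𝕜 →L[ℝ] ℝ) (hU : ContDiffOn ℝ ∞ U {0}ᶜ) (i : Fin N) {x : Pt N}
    (hx : x ≠ 0) : HasFDerivAt (component ℓ U i)
      ((ℓ ∘L (EuclideanSpace.proj i : EuclideanSpace 𝕜 (Fin N) →L[𝕜] 𝕜).restrictScalars ℝ) ∘L
        fderiv ℝ U x) x := by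
  have h1 : DifferentiableAt ℝ U x :=
    (hU.contDiffAt (isOpen_compl_singleton.mem_nhds hx)).differentiableAt (by simp)
  exact (ℓ ∘L (EuclideanSpace.proj i : EuclideanSpace 𝕜 (Fin N) →L[𝕜] 𝕜).restrictScalars
    ℝ).hasFDerivAt.comp x h1.hasFDerivAt

lemma partialD_component (ℓ : 𝕜 →L[ℝ] ℝ) (hU : ContDiffOn ℝ ∞ U {0}ᶜ) (i j : Fin N) {x : Pt N}
    (hx : x ≠ 0) : partialD (component ℓ U i) j x = ℓ (pderiv U j i x) := by
  rw [partialD, (hasFDerivAt_component ℓ hU i hx).fderiv]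
  rfl

lemma closedForm_component (ℓ : 𝕜 →L[ℝ] ℝ) (hU : ContDiffOn ℝ ∞ U {0}ᶜ) (hc : CurlFree U) :
    ClosedForm (component ℓ U) where
  smooth i := (ℓ ∘L (EuclideanSpace.proj i : EuclideanSpace 𝕜 (Fin N) →L[𝕜] 𝕜).restrictScalars
    ℝ).contDiff.comp_contDiffOn hU
  closed x hx i j := by
    rw [partialD_component ℓ hU _ _ hx, partialD_component ℓ hU _ _ hx, hc x hx]

lemma re_sq_add_im_sq (z : 𝕜) : RCLike.reCLM z ^ 2 + RCLike.imCLM z ^ 2 = ‖z‖ ^ 2 := by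
  rw [RCLike.norm_sq_eq_def]; simp [sq]

lemma normSq_re_add_im (U : Field 𝕜 N) (x : Pt N) :
    normSq (component RCLike.reCLM U) x + normSq (component RCLike.imCLM U) x = ‖U x‖ ^ 2 := by
  simp_rw [normSq, component, ← Finset.sum_add_distrib, re_sq_add_im_sq,
    EuclideanSpace.norm_sq_eq]

lemma jacSq_re_add_im (hU : ContDiffOn ℝ ∞ U {0}ᶜ) {x : Pt N} (hx : x ≠ 0) :
    jacSq (component RCLike.reCLM U) x + jacSq (component RCLike.imCLM U) x = gradSq U x := by
  simp_rw [jacSq, partialD_component _ hU _ _ hx, ← Finset.sum_add_distrib, re_sq_add_im_sq,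
    gradSq]

lemma normSq_component_le (U : Field 𝕜 N) (x : Pt N) :
    normSq (component RCLike.reCLM U) x ≤ ‖U x‖ ^ 2 ∧
      normSq (component RCLike.imCLM U) x ≤ ‖U x‖ ^ 2 := by
  have h := normSq_re_add_im U x
  have h1 := normSq_nonneg (u := component RCLike.reCLM U) x
  have h2 := normSq_nonneg (u := component RCLike.imCLM U) x
  constructor <;> linarith

/-- The product of two decay conditions on a field is a decay condition on its square. -/
lemma tendsto_norm_rpow_mul_sq {l : Filter (Pt N)} (hl : ∀ᶠ x in l, x ≠ 0) {m₁ m₂ m : ℝ}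
    (h₁ : Tendsto (fun x => ‖x‖ ^ m₁ • U x) l (𝓝 0))
    (h₂ : Tendsto (fun x => ‖x‖ ^ m₂ • U x) l (𝓝 0)) (hm : m₁ + m₂ = m) :
    Tendsto (fun x => ‖x‖ ^ m * ‖U x‖ ^ 2) l (𝓝 0) := by
  have := h₁.norm.mul h₂.norm
  rw [norm_zero, mul_zero] at this
  refine this.congr' ?_
  filter_upwards [hl] with x hx
  rw [norm_smul, norm_smul, Real.norm_of_nonneg (by positivity), Real.norm_of_nonneg (by positivity),
    ← hm, Real.rpow_add (norm_pos_iff.2 hx)]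
  ring

lemma tendsto_norm_rpow_mul_normSq {u : Fin N → Pt N → ℝ} {l : Filter (Pt N)} {m : ℝ}
    (h : Tendsto (fun x => ‖x‖ ^ m * ‖U x‖ ^ 2) l (𝓝 0)) (hu : ∀ x, normSq u x ≤ ‖U x‖ ^ 2) :
    Tendsto (fun x => ‖x‖ ^ m * normSq u x) l (𝓝 0) :=
  squeeze_zero (fun x => mul_nonneg (by positivity) (normSq_nonneg x))
    (fun x => mul_le_mul_of_nonneg_left (hu x) (by positivity)) h

lemma tendsto_fluxDensity {u : Fin N → Pt N → ℝ} {l : Filter (Pt N)} (hl : ∀ᶠ x in l, x ≠ 0)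
    {a q c s β : ℝ} (hsa : 2 * s = 2 * a + 2 - N)
    (h₁ : Tendsto (fun x => ‖x‖ ^ (-2 * s) * normSq u x) l (𝓝 0))
    (h₂ : Tendsto (fun x => ‖x‖ ^ (q - 2 * s) * normSq u x) l (𝓝 0)) :
    Tendsto (fun x => ‖x‖ ^ N * fluxDensity a q c s β u x) l (𝓝 0) := by
  have h3 : Tendsto (fun x => ‖x‖ ^ N * (‖x‖ ^ (-2 * a - 4) * tangNormSq u x)) l (𝓝 0) := by
    refine squeeze_zero' (Eventually.of_forall fun x =>
      mul_nonneg (by positivity) (mul_nonneg (by positivity) (tangNormSq_nonneg x))) ?_ h₁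
    filter_upwards [hl] with x hx
    have hx0 := norm_pos_iff.2 hx
    have e : ‖x‖ ^ (-2 * s) = ‖x‖ ^ N * ‖x‖ ^ (-2 * a - 4) * ‖x‖ ^ 2 := by
      rw [← Real.rpow_natCast, ← Real.rpow_natCast, ← Real.rpow_add hx0, ← Real.rpow_add hx0]
      congr 1; push_cast; linarith
    rw [e, ← mul_assoc, mul_assoc (_ * _) (‖x‖ ^ 2)]
    exact mul_le_mul_of_nonneg_left (tangNormSq_le x) (by positivity)
  have := ((h3.const_mul (s - 1)).add (h₁.const_mul c)).sub (h₂.const_mul β)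
  simp only [mul_zero, add_zero, sub_zero] at this
  refine this.congr' ?_
  filter_upwards [hl] with x hx
  have hx0 := norm_pos_iff.2 hx
  have e1 : ‖x‖ ^ (-2 * s) = ‖x‖ ^ N * ‖x‖ ^ (-2 * a - 2) := by
    rw [← Real.rpow_natCast, ← Real.rpow_add hx0]; congr 1; linarith
  have e2 : ‖x‖ ^ (q - 2 * s) = ‖x‖ ^ N * ‖x‖ ^ (q - 2 * a - 2) := by
    rw [← Real.rpow_natCast, ← Real.rpow_add hx0]; congr 1; linarith
  rw [e1, e2, fluxDensity]
  ring

/-- The quadratic form `A + β² B - β (q + 2 (c - s)) M` of a curl-free field is nonnegative. -/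
theorem quadForm_nonneg (hN : 2 ≤ N) {a b q c s β : ℝ} (hs : (N : ℝ) + 1 ≤ (s - 1) ^ 2)
    (hc : c ^ 2 - 2 * c * s = N - 1) (hsa : s = a + 1 - N / 2) (hq : q = a - b + 1)
    (hU : MemX a b U) (hcurl : CurlFree U) :
    0 ≤ (∫ x, gradDensity a U x) + β ^ 2 * (∫ x, density (2 * b) U x)
      - β * (q + 2 * (c - s)) * ∫ x, density (a + b + 1) U x := by
  have : NeZero N := ⟨by omega⟩
  have hsa' : 2 * s = 2 * a + 2 - N := by linarith
  have hre := closedForm_component RCLike.reCLM hU.smooth hcurl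
  have him := closedForm_component RCLike.imCLM hU.smooth hcurl
  have hz : ∀ᶠ x : Pt N in 𝓝[≠] 0, x ≠ 0 := eventually_mem_nhdsWithin
  have hi : ∀ᶠ x : Pt N in Bornology.cobounded _, x ≠ 0 := Bornology.eventually_ne_cobounded 0
  have z1 := tendsto_norm_rpow_mul_sq hz hU.tendsto_zero_a hU.tendsto_zero_a
    (m := -2 * s) (by linarith)
  have z2 := tendsto_norm_rpow_mul_sq hz hU.tendsto_zero_a hU.tendsto_zero_b
    (m := q - 2 * s) (by linarith)
  have i1 := tendsto_norm_rpow_mul_sq hi hU.tendsto_infty_a hU.tendsto_infty_a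
    (m := -2 * s) (by linarith)
  have i2 := tendsto_norm_rpow_mul_sq hi hU.tendsto_infty_a hU.tendsto_infty_b
    (m := q - 2 * s) (by linarith)
  have lre := fun x => (normSq_component_le U x).1
  have lim := fun x => (normSq_component_le U x).2
  let Ψ : (𝕜 →L[ℝ] ℝ) → Pt N → ℝ := fun ℓ => quadDensity a q c s β (component ℓ U)
  let G : (𝕜 →L[ℝ] ℝ) → Pt N → ℝ := fun ℓ => fluxDensity a q c s β (component ℓ U)
  have hΨ : ∀ x, x ≠ 0 → gradDensity a U x + β ^ 2 * density (2 * b) U x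
      - β * (q + 2 * (c - s)) * density (a + b + 1) U x =
      Ψ RCLike.reCLM x + Ψ RCLike.imCLM x := by
    intro x hx
    have hx0 := norm_pos_iff.2 hx
    have e1 : (‖x‖ ^ (2 * a))⁻¹ = ‖x‖ ^ (-2 * a - 2) * ‖x‖ ^ 2 := by
      rw [← Real.rpow_neg hx0.le, ← Real.rpow_natCast, ← Real.rpow_add hx0]
      congr 1; push_cast; ring
    have e2 : (‖x‖ ^ (2 * b))⁻¹ = ‖x‖ ^ (-2 * a - 2) * (‖x‖ ^ q) ^ 2 := by
      rw [← Real.rpow_neg hx0.le, ← Real.rpow_natCast, ← Real.rpow_mul hx0.le,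
        ← Real.rpow_add hx0]
      congr 1; push_cast; rw [hq]; ring
    have e3 : (‖x‖ ^ (a + b + 1))⁻¹ = ‖x‖ ^ (-2 * a - 2) * ‖x‖ ^ q := by
      rw [← Real.rpow_neg hx0.le, ← Real.rpow_add hx0]
      congr 1; rw [hq]; ring
    rw [gradDensity, density, density, ← jacSq_re_add_im hU.smooth hx, ← normSq_re_add_im U x,
      div_eq_mul_inv, div_eq_mul_inv, div_eq_mul_inv, e1, e2, e3]
    simp only [Ψ, quadDensity]
    ring
  have hint := (hU.integrable_grad.add (hU.integrable_left.const_mul (β ^ 2))).sub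
    (hU.integrable_mid.const_mul (β * (q + 2 * (c - s))))
  have hint' : Integrable fun x => Ψ RCLike.reCLM x + Ψ RCLike.imCLM x := by
    refine hint.congr ?_
    filter_upwards [ae_ne_zero] with x hx using hΨ x hx
  have hGre : ContinuousOn (G RCLike.reCLM) {0}ᶜ := continuousOn_fluxDensity hre.smooth _ _ _ _ _
  have hGim : ContinuousOn (G RCLike.imCLM) {0}ᶜ := continuousOn_fluxDensity him.smooth _ _ _ _ _
  have key : 0 ≤ ∫ x, (Ψ RCLike.reCLM x + Ψ RCLike.imCLM x) := by
    refine integral_nonneg_of_cutoff (G := fun x => G RCLike.reCLM x + G RCLike.imCLM x) hint'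
      (hGre.add hGim) ?_ ?_ fun χ hχ hχ0 => ?_
    · simpa only [mul_add, add_zero] using
        (tendsto_fluxDensity (c := c) (β := β) hz hsa' (tendsto_norm_rpow_mul_normSq z1 lre)
          (tendsto_norm_rpow_mul_normSq z2 lre)).add
        (tendsto_fluxDensity (c := c) (β := β) hz hsa' (tendsto_norm_rpow_mul_normSq z1 lim)
          (tendsto_norm_rpow_mul_normSq z2 lim))
    · simpa only [mul_add, add_zero] using
        (tendsto_fluxDensity (c := c) (β := β) hi hsa' (tendsto_norm_rpow_mul_normSq i1 lre)
          (tendsto_norm_rpow_mul_normSq i2 lre)).add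
        (tendsto_fluxDensity (c := c) (β := β) hi hsa' (tendsto_norm_rpow_mul_normSq i1 lim)
          (tendsto_norm_rpow_mul_normSq i2 lim))
    · have r1 := hre.integral_quadDensity_ge (q := q) (β := β) hN hs hc hsa'
        (tendsto_norm_rpow_mul_normSq z1 lre) (tendsto_norm_rpow_mul_normSq i1 lre) hχ hχ0
      have r2 := him.integral_quadDensity_ge (q := q) (β := β) hN hs hc hsa'
        (tendsto_norm_rpow_mul_normSq z1 lim) (tendsto_norm_rpow_mul_normSq i1 lim) hχ hχ0
      simp_rw [mul_add]
      rw [integral_add (hχ.integrable_euler_mul hGre) (hχ.integrable_euler_mul hGim),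
        integral_add (hχ.integrable_mul (continuousOn_quadDensity hre.smooth _ _ _ _ _))
          (hχ.integrable_mul (continuousOn_quadDensity him.smooth _ _ _ _ _))]
      linarith
  have hfinal : (∫ x, gradDensity a U x) + β ^ 2 * (∫ x, density (2 * b) U x)
      - β * (q + 2 * (c - s)) * (∫ x, density (a + b + 1) U x) =
      ∫ x, (Ψ RCLike.reCLM x + Ψ RCLike.imCLM x) := by
    have h1 : Integrable fun x => gradDensity a U x + β ^ 2 * density (2 * b) U x :=
      hU.integrable_grad.add (hU.integrable_left.const_mul (β ^ 2))
    rw [← integral_congr_off hΨ, integral_sub h1 (hU.integrable_mid.const_mul _),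
      integral_add hU.integrable_grad (hU.integrable_left.const_mul (β ^ 2)),
      integral_const_mul, integral_const_mul]
  rw [hfinal]
  exact key

lemma density_nonneg (p : ℝ) (U : Field 𝕜 N) (x : Pt N) : 0 ≤ density p U x := by
  unfold density; positivity

lemma gradDensity_nonneg (a : ℝ) (U : Field 𝕜 N) (x : Pt N) : 0 ≤ gradDensity a U x :=
  div_nonneg (Finset.sum_nonneg fun _ _ => Finset.sum_nonneg fun _ _ => sq_nonneg _) (by positivity)

lemma rate_sq (hN : 2 ≤ N) (a : ℝ) : rate N a ^ 2 = (1 - (N : ℝ) / 2 + a) ^ 2 + N - 1 := by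
  have : (2 : ℝ) ≤ N := by exact_mod_cast hN
  exact Real.sq_sqrt (by nlinarith [sq_nonneg (1 - (N : ℝ) / 2 + a)])

lemma rate_pos (hN : 2 ≤ N) (a : ℝ) : 0 < rate N a := by
  have : (2 : ℝ) ≤ N := by exact_mod_cast hN
  exact Real.sqrt_pos.2 (by nlinarith [sq_nonneg (1 - (N : ℝ) / 2 + a)])

/-- The inequality, for both signs `ε = ±1` of `a - b + 1`. -/
theorem admissible_of_sign (𝕜 : Type*) [RCLike 𝕜] (hN : 2 ≤ N) {a b ε : ℝ}
    (h : ((N : ℝ) / 2 - a) ^ 2 ≥ N + 1) (hε : ε ^ 2 = 1) (hq : 0 < ε * (a - b + 1)) :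
    Admissible 𝕜 N a b ((ε * rate N a + (a - b + 1) / 2) ^ 2) := by
  intro U hU hcurl
  set A := ∫ x, gradDensity a U x
  set B := ∫ x, density (2 * b) U x
  set M := ∫ x, density (a + b + 1) U x
  have hA : 0 ≤ A := integral_nonneg (gradDensity_nonneg a U)
  have hB : 0 ≤ B := integral_nonneg (density_nonneg _ U)
  have hM : 0 ≤ M := integral_nonneg (density_nonneg _ U)
  have hr := rate_sq hN a
  have hr0 := rate_pos hN a
  have hquad : ∀ t : ℝ, 0 ≤ B * (t * t)
      + (-2 * (rate N a + ε * (a - b + 1) / 2) * M) * t + A := by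
    intro t
    rcases le_or_gt t 0 with ht | ht
    · have h1 : 0 ≤ (rate N a + ε * (a - b + 1) / 2) * M := mul_nonneg (by linarith) hM
      nlinarith [mul_nonneg hB (mul_self_nonneg t), mul_nonneg h1 (neg_nonneg.2 ht)]
    · have := quadForm_nonneg (β := ε * t) (s := a + 1 - N / 2)
        (c := a + 1 - N / 2 + ε * rate N a) hN (by nlinarith)
        (by linear_combination hr + rate N a ^ 2 * hε) rfl rfl hU hcurl
      refine this.trans_eq ?_
      linear_combination (t ^ 2 * B - 2 * rate N a * t * M) * hε
  have hd := discrim_le_zero hquad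
  rw [discrim] at hd
  have e : (ε * rate N a + (a - b + 1) / 2) ^ 2 = (rate N a + ε * (a - b + 1) / 2) ^ 2 := by
    linear_combination (rate N a ^ 2 - (a - b + 1) ^ 2 / 4) * hε
  rw [e]
  nlinarith

end Fields

/-! ### The extremal fields -/

section Extremal

variable {N : ℕ} {q b z : ℝ}

/-- The radial function whose integral is a Gamma value after the substitution `y = |x|^q`. -/
def gammaProfile (N : ℕ) (q b z : ℝ) (x : Pt N) : ℝ :=
  ‖x‖ ^ (q * z - N) * Real.exp (-(b * ‖x‖ ^ q))

lemma radial_weight_eq (hN : 0 < N) (hq : q ≠ 0) {y : ℝ} (hy : 0 < y) :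
    y ^ (N - 1) • (y ^ (q * z - N) * Real.exp (-(b * y ^ q))) =
      |q|⁻¹ * ((|q| * y ^ (q - 1)) • ((y ^ q) ^ (z - 1) * Real.exp (-(b * y ^ q)))) := by
  have h1 : y ^ (N - 1) * y ^ (q * z - N) = y ^ (q - 1) * (y ^ q) ^ (z - 1) := by
    rw [← Real.rpow_natCast, ← Real.rpow_mul hy.le, ← Real.rpow_add hy, ← Real.rpow_add hy,
      Nat.cast_sub hN]
    congr 1; push_cast; ring
  have h2 : |q| ≠ 0 := abs_ne_zero.2 hq
  simp only [smul_eq_mul]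
  rw [← mul_assoc, h1]
  field_simp

lemma integrableOn_rpow_mul_exp (hb : 0 < b) (hz : 0 < z) :
    IntegrableOn (fun y : ℝ => y ^ (z - 1) * Real.exp (-(b * y))) (Set.Ioi 0) := by
  have := integrableOn_rpow_mul_exp_neg_mul_rpow (p := 1) (s := z - 1) (by linarith) one_pos hb
  simpa using this

lemma integrable_gammaProfile (hN : 0 < N) (hq : q ≠ 0) (hb : 0 < b) (hz : 0 < z) :
    Integrable (gammaProfile N q b z) := by
  have : NeZero N := ⟨hN.ne'⟩
  refine (integrable_fun_norm_addHaar volume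
    (f := fun y => y ^ (q * z - N) * Real.exp (-(b * y ^ q)))).2 ?_
  rw [finrank_euclideanSpace, Fintype.card_fin]
  refine IntegrableOn.congr_fun (((integrableOn_Ioi_comp_rpow_iff _ hq).2
    (integrableOn_rpow_mul_exp hb hz)).const_mul |q|⁻¹) (fun y hy => ?_) measurableSet_Ioi
  exact (radial_weight_eq hN hq hy).symm

lemma integral_gammaProfile (hN : 0 < N) (hq : q ≠ 0) (hb : 0 < b) (hz : 0 < z) :
    ∫ x, gammaProfile N q b z x =
      N * volume.real (Metric.ball (0 : Pt N) 1) * |q|⁻¹ * ((1 / b) ^ z * Real.Gamma z) := by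
  have : NeZero N := ⟨hN.ne'⟩
  have h := integral_fun_norm_addHaar (volume : Measure (Pt N))
    (fun y => y ^ (q * z - N) * Real.exp (-(b * y ^ q)))
  rw [finrank_euclideanSpace, Fintype.card_fin] at h
  rw [← Real.integral_rpow_mul_exp_neg_mul_Ioi hz hb, ← integral_comp_rpow_Ioi _ hq]
  refine h.trans ?_
  rw [setIntegral_congr_fun measurableSet_Ioi fun y hy => radial_weight_eq hN hq hy,
    integral_const_mul]
  simp only [smul_eq_mul, nsmul_eq_mul]
  ring

lemma integral_gammaProfile_pos (hN : 0 < N) (hq : q ≠ 0) (hb : 0 < b) (hz : 0 < z) :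
    0 < ∫ x, gammaProfile N q b z x := by
  have : NeZero N := ⟨hN.ne'⟩
  have h1 : 0 < volume.real (Metric.ball (0 : Pt N) 1) :=
    ENNReal.toReal_pos (Metric.measure_ball_pos volume 0 one_pos).ne' measure_ball_lt_top.ne
  have h2 := Real.Gamma_pos_of_pos hz
  have h3 : (0 : ℝ) < N := by exact_mod_cast hN
  have h4 : 0 < |q| := abs_pos.2 hq
  rw [integral_gammaProfile hN hq hb hz]
  positivity

lemma integral_gammaProfile_add_one (hN : 0 < N) (hq : q ≠ 0) (hb : 0 < b) (hz : 0 < z) :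
    b * ∫ x, gammaProfile N q b (z + 1) x = z * ∫ x, gammaProfile N q b z x := by
  rw [integral_gammaProfile hN hq hb (by linarith), integral_gammaProfile hN hq hb hz,
    Real.Gamma_add_one hz.ne', Real.rpow_add (by positivity), Real.rpow_one]
  field_simp

lemma tendsto_norm_rpow_nhdsNE_zero (hq : q ≠ 0) :
    Tendsto (fun x : Pt N => ‖x‖ ^ q) (𝓝[≠] 0) (if 0 < q then 𝓝[>] 0 else atTop) := by
  split_ifs with h
  · refine tendsto_nhdsWithin_iff.2 ⟨?_, ?_⟩
    · have h1 : Tendsto (fun y : ℝ => y ^ q) (𝓝 0) (𝓝 0) := by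
        simpa [Real.zero_rpow hq] using (Real.continuousAt_rpow_const 0 q (Or.inr h.le)).tendsto
      exact h1.comp (tendsto_norm_nhdsNE_zero.mono_right nhdsWithin_le_nhds)
    · filter_upwards [eventually_mem_nhdsWithin] with x hx
      exact Real.rpow_pos_of_pos (norm_pos_iff.2 hx) _
  · exact (tendsto_rpow_neg_nhdsGT_zero (lt_of_le_of_ne (not_lt.1 h) hq)).comp
      tendsto_norm_nhdsNE_zero

lemma tendsto_norm_rpow_cobounded (hq : q ≠ 0) :
    Tendsto (fun x : Pt N => ‖x‖ ^ q) (Bornology.cobounded _)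
      (if 0 < q then atTop else 𝓝[>] 0) := by
  split_ifs with h
  · exact (tendsto_rpow_atTop h).comp tendsto_norm_cobounded_atTop
  · have hq' : 0 < -q := by
      have := lt_of_le_of_ne (not_lt.1 h) hq
      linarith
    refine tendsto_nhdsWithin_iff.2 ⟨?_, ?_⟩
    · simpa using! (tendsto_rpow_neg_atTop hq').comp tendsto_norm_cobounded_atTop
    · filter_upwards [Bornology.eventually_ne_cobounded 0] with x hx
      exact Real.rpow_pos_of_pos (norm_pos_iff.2 hx) _

lemma tendsto_rpow_mul_exp_nhdsGT_zero (hz : 0 < z) (b : ℝ) :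
    Tendsto (fun y : ℝ => y ^ z * Real.exp (-b * y)) (𝓝[>] 0) (𝓝 0) := by
  have h1 : ContinuousAt (fun y : ℝ => y ^ z * Real.exp (-b * y)) 0 :=
    (Real.continuousAt_rpow_const 0 z (Or.inr hz.le)).mul (by fun_prop)
  have := h1.tendsto
  rw [Real.zero_rpow hz.ne', zero_mul] at this
  exact this.mono_left nhdsWithin_le_nhds

lemma tendsto_norm_rpow_mul_exp (hq : q ≠ 0) (hb : 0 < b) (hz : 0 < z) :
    Tendsto (fun x : Pt N => ‖x‖ ^ (q * z) * Real.exp (-b * ‖x‖ ^ q)) (𝓝[≠] 0) (𝓝 0) ∧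
    Tendsto (fun x : Pt N => ‖x‖ ^ (q * z) * Real.exp (-b * ‖x‖ ^ q)) (Bornology.cobounded _)
      (𝓝 0) := by
  have h0 := tendsto_rpow_mul_exp_nhdsGT_zero hz b
  have h1 := tendsto_rpow_mul_exp_neg_mul_atTop_nhds_zero z b hb
  have e : ∀ x : Pt N, ‖x‖ ^ (q * z) = (‖x‖ ^ q) ^ z := fun x => Real.rpow_mul (norm_nonneg x) _ _
  simp_rw [e]
  constructor
  · refine Tendsto.comp (g := fun y : ℝ => y ^ z * Real.exp (-b * y)) ?_
      (tendsto_norm_rpow_nhdsNE_zero hq)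
    split_ifs <;> assumption
  · refine Tendsto.comp (g := fun y : ℝ => y ^ z * Real.exp (-b * y)) ?_
      (tendsto_norm_rpow_cobounded hq)
    split_ifs <;> assumption

/-- The scalar factor of `radialField`. -/
def radialFactor (N : ℕ) (p q γ β : ℝ) (x : Pt N) : ℝ :=
  γ * ‖x‖ ^ p * Real.exp (-(β / q) * ‖x‖ ^ q)

variable (𝕜 : Type*) [RCLike 𝕜] {p γ β : ℝ}

lemma radialField_apply (x : Pt N) (i : Fin N) :
    radialField 𝕜 N p q γ β x i = ((radialFactor N p q γ β x * x i : ℝ) : 𝕜) := rfl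

lemma norm_radialField_sq (x : Pt N) :
    ‖radialField 𝕜 N p q γ β x‖ ^ 2 = radialFactor N p q γ β x ^ 2 * ‖x‖ ^ 2 := by
  simp_rw [EuclideanSpace.norm_sq_eq, radialField_apply, RCLike.norm_ofReal, sq_abs, mul_pow,
    ← Finset.mul_sum, Real.norm_eq_abs, sq_abs]

lemma smoothOff_radialFactor : SmoothOff (radialFactor N p q γ β) :=
  ((smoothOff_const γ).mul (smoothOff_norm_rpow p)).mul
    (Real.contDiff_exp.comp_contDiffOn ((smoothOff_const (-(β / q))).mul (smoothOff_norm_rpow q)))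

lemma contDiffOn_radialField : ContDiffOn ℝ ∞ (radialField 𝕜 N p q γ β) {0}ᶜ := by
  have e : radialField 𝕜 N p q γ β = fun x => ∑ i, (radialFactor N p q γ β x * x i) •
      (EuclideanSpace.single i (1 : 𝕜) : EuclideanSpace 𝕜 (Fin N)) := by
    ext x i
    simp [radialField_apply, RCLike.real_smul_eq_coe_mul, Finset.sum_apply, Pi.single_apply]
  rw [e]
  exact ContDiffOn.sum fun i _ =>
    (smoothOff_radialFactor.mul (smoothOff_coord i)).smul contDiffOn_const

lemma partialD_radialFactor (hq : q ≠ 0) {x : Pt N} (hx : x ≠ 0) (j : Fin N) :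
    partialD (radialFactor N p q γ β) j x =
      radialFactor N p q γ β x * (p - β * ‖x‖ ^ q) * ‖x‖ ^ (-2 : ℝ) * x j := by
  have hx0 := norm_pos_iff.2 hx
  have h1 := (smoothOff_norm_rpow (N := N) p).differentiableAt hx
  have h2 := (smoothOff_norm_rpow (N := N) q).differentiableAt hx
  have h3 : DifferentiableAt ℝ (fun x : Pt N => -(β / q) * ‖x‖ ^ q) x := h2.const_mul _
  have e1 : partialD (fun x : Pt N => γ * ‖x‖ ^ p) j x = γ * (p * ‖x‖ ^ (p - 2) * x j) := by
    rw [← partialD_norm_rpow hx]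
    simp [partialD, fderiv_const_mul h1]
  have e2 : partialD (fun x : Pt N => Real.exp (-(β / q) * ‖x‖ ^ q)) j x =
      Real.exp (-(β / q) * ‖x‖ ^ q) * (-(β / q) * (q * ‖x‖ ^ (q - 2) * x j)) := by
    rw [← partialD_norm_rpow hx]
    rw [partialD, fderiv_exp h3, fderiv_const_mul h2]
    simp [partialD]
  have e3 : partialD (radialFactor N p q γ β) j x = _ :=
    partialD_mul (h1.const_mul γ) h3.exp j
  rw [e3, e1, e2, radialFactor, sub_eq_add_neg p, sub_eq_add_neg q, Real.rpow_add hx0,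
    Real.rpow_add hx0]
  field_simp
  ring

lemma pderiv_radialField (hq : q ≠ 0) {x : Pt N} (hx : x ≠ 0) (j k : Fin N) :
    pderiv (radialField 𝕜 N p q γ β) j k x = ((radialFactor N p q γ β x *
      ((if j = k then 1 else 0) + (p - β * ‖x‖ ^ q) * ‖x‖ ^ (-2 : ℝ) * x j * x k) : ℝ) : 𝕜) := by
  have hs := contDiffOn_radialField 𝕜 (N := N) (p := p) (q := q) (γ := γ) (β := β)
  have hd : partialD (fun x => radialFactor N p q γ β x * x k) j x = radialFactor N p q γ β x *
      ((if j = k then 1 else 0) + (p - β * ‖x‖ ^ q) * ‖x‖ ^ (-2 : ℝ) * x j * x k) := by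
    rw [partialD_mul (smoothOff_radialFactor.differentiableAt hx)
      ((smoothOff_coord k).differentiableAt hx), partialD_radialFactor hq hx, partialD_coord]
    ring
  have hre := partialD_component RCLike.reCLM hs k j hx
  have him := partialD_component RCLike.imCLM hs k j hx
  have e1 : component RCLike.reCLM (radialField 𝕜 N p q γ β) k =
      fun x => radialFactor N p q γ β x * x k := by
    ext y; simp [component, radialField_apply]
  have e2 : component RCLike.imCLM (radialField 𝕜 N p q γ β) k = fun _ => 0 := by
    ext y; simp [component, radialField_apply]
  rw [e1, hd] at hre
  rw [e2] at him
  refine RCLike.ext ?_ ?_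
  · rw [RCLike.ofReal_re]; exact hre.symm
  · rw [RCLike.ofReal_im]; exact him.symm.trans (by simp [partialD])

lemma curlFree_radialField (hq : q ≠ 0) : CurlFree (radialField 𝕜 N p q γ β) := by
  intro x hx j k
  rw [pderiv_radialField 𝕜 hq hx, pderiv_radialField 𝕜 hq hx]
  congr 2
  simp only [eq_comm (a := j)]
  ring

lemma gradSq_radialField (hq : q ≠ 0) {x : Pt N} (hx : x ≠ 0) :
    gradSq (radialField 𝕜 N p q γ β) x =
      radialFactor N p q γ β x ^ 2 * ((1 + p - β * ‖x‖ ^ q) ^ 2 + (N - 1)) := by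
  have hx0 := norm_pos_iff.2 hx
  simp_rw [gradSq, pderiv_radialField 𝕜 hq hx, RCLike.norm_ofReal, sq_abs]
  set w := radialFactor N p q γ β x
  set μ := p - β * ‖x‖ ^ q with hμ
  set ν := ‖x‖ ^ (-2 : ℝ) with hν
  have hn : ν * ‖x‖ ^ 2 = 1 := by
    rw [hν, Real.rpow_neg hx0.le]
    simp [hx0.ne']
  have h1 : ∀ j k : Fin N, (w * ((if j = k then 1 else 0) + μ * ν * x j * x k)) ^ 2 =
      w ^ 2 * (1 + 2 * μ * ν * (x j * x k)) * (if j = k then 1 else 0)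
        + w ^ 2 * μ ^ 2 * ν ^ 2 * (x j ^ 2 * x k ^ 2) := by
    intro j k; split_ifs <;> ring
  simp_rw [h1, Finset.sum_add_distrib, ← Finset.mul_sum, ← EuclideanSpace.real_norm_sq_eq]
  simp only [mul_ite, mul_one, mul_zero, Finset.sum_ite_eq, Finset.mem_univ, if_true, ← sq,
    ← Finset.mul_sum, ← Finset.sum_mul, Finset.sum_add_distrib, Finset.sum_const, Finset.card_univ,
    Fintype.card_fin, nsmul_eq_mul, ← EuclideanSpace.real_norm_sq_eq]
  have h2 : (1 + p - β * ‖x‖ ^ q) = 1 + μ := by rw [hμ]; ring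
  rw [h2]
  linear_combination (2 * w ^ 2 * μ + w ^ 2 * μ ^ 2 * (ν * ‖x‖ ^ 2 + 1)) * hn

end Extremal

section Equality

variable {N : ℕ} {q p γ β : ℝ} (𝕜 : Type*) [RCLike 𝕜]

lemma radialFactor_sq_mul {x : Pt N} (hx : x ≠ 0) (m z : ℝ) (hm : 2 * p + m = q * z - N) :
    radialFactor N p q γ β x ^ 2 * ‖x‖ ^ m = γ ^ 2 * gammaProfile N q (2 * β / q) z x := by
  have hx0 := norm_pos_iff.2 hx
  rw [radialFactor, gammaProfile, ← hm, Real.rpow_add hx0, mul_pow, mul_pow, ← Real.rpow_natCast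
    (‖x‖ ^ p), ← Real.rpow_mul hx0.le, ← Real.exp_nat_mul]
  have e : ((2 : ℕ) : ℝ) * (-(β / q) * ‖x‖ ^ q) = -(2 * β / q * ‖x‖ ^ q) := by push_cast; ring
  rw [e]
  push_cast
  rw [mul_comm p 2]
  ring

lemma density_radialField {x : Pt N} (hx : x ≠ 0) (m z : ℝ) (hm : 2 * p + 2 - m = q * z - N) :
    density m (radialField 𝕜 N p q γ β) x = γ ^ 2 * gammaProfile N q (2 * β / q) z x := by
  have hx0 := norm_pos_iff.2 hx
  rw [density, norm_radialField_sq, ← radialFactor_sq_mul (p := p) hx (2 - m) z (by linarith),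
    Real.rpow_sub hx0]
  simp
  ring

lemma gradDensity_radialField (hq : q ≠ 0) {x : Pt N} (hx : x ≠ 0) (a z : ℝ)
    (hm : 2 * p - 2 * a = q * z - N) :
    gradDensity a (radialField 𝕜 N p q γ β) x =
      γ ^ 2 * (((1 + p) ^ 2 + (N - 1)) * gammaProfile N q (2 * β / q) z x
        - 2 * (1 + p) * β * gammaProfile N q (2 * β / q) (z + 1) x
        + β ^ 2 * gammaProfile N q (2 * β / q) (z + 2) x) := by
  have hx0 := norm_pos_iff.2 hx
  have e0 := radialFactor_sq_mul (p := p) (q := q) (γ := γ) (β := β) hx (-2 * a) z (by linarith)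
  have e1 := radialFactor_sq_mul (p := p) (q := q) (γ := γ) (β := β) hx (-2 * a + q) (z + 1) (by linarith)
  have e2 := radialFactor_sq_mul (p := p) (q := q) (γ := γ) (β := β) hx (-2 * a + q + q) (z + 2) (by linarith)
  rw [Real.rpow_add hx0] at e1 e2
  rw [Real.rpow_add hx0] at e2
  rw [gradDensity, gradSq_radialField 𝕜 hq hx, div_eq_mul_inv, ← Real.rpow_neg hx0.le, ← neg_mul]
  linear_combination ((1 + p) ^ 2 + (N - 1)) * e0 - 2 * (1 + p) * β * e1 + β ^ 2 * e2

lemma tendsto_radialField {l : Filter (Pt N)} (hl : ∀ᶠ x in l, x ≠ 0) {m z : ℝ}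
    (hm : m + p + 1 = q * z)
    (h : Tendsto (fun x : Pt N => ‖x‖ ^ (q * z) * Real.exp (-(β / q) * ‖x‖ ^ q)) l (𝓝 0)) :
    Tendsto (fun x => ‖x‖ ^ m • radialField 𝕜 N p q γ β x) l (𝓝 0) := by
  rw [tendsto_zero_iff_norm_tendsto_zero]
  have := h.const_mul |γ|
  rw [mul_zero] at this
  refine this.congr' ?_
  filter_upwards [hl] with x hx
  have hx0 := norm_pos_iff.2 hx
  have e : ‖radialField 𝕜 N p q γ β x‖ = |radialFactor N p q γ β x| * ‖x‖ := by
    rw [← sq_eq_sq₀ (norm_nonneg _) (by positivity), norm_radialField_sq, mul_pow, sq_abs]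
  rw [norm_smul, e, ← hm, Real.rpow_add hx0, Real.rpow_add hx0, radialFactor, abs_mul, abs_mul,
    Real.abs_exp, abs_of_nonneg (by positivity : 0 ≤ ‖x‖ ^ p), Real.rpow_one,
    Real.norm_of_nonneg (by positivity)]
  ring

/-- The radial fields with exponent `-N/2 + a + ερ`, where `ε = ±1` is the sign of `a - b + 1`,
are extremal. -/
theorem isExtremal_radialField (hN : 2 ≤ N) {a b ε : ℝ} (hε : ε ^ 2 = 1)
    (hq : 0 < ε * (a - b + 1)) (γ : ℝ) {β : ℝ} (hβ : 0 < β * (a - b + 1)) :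
    IsExtremal a b ((ε * rate N a + (a - b + 1) / 2) ^ 2)
      (radialField 𝕜 N (-(N : ℝ) / 2 + a + ε * rate N a) (a - b + 1) γ β) ∧
    (γ ≠ 0 → 0 < ∫ x, density (a + b + 1)
      (radialField 𝕜 N (-(N : ℝ) / 2 + a + ε * rate N a) (a - b + 1) γ β) x) := by
  have : NeZero N := ⟨by omega⟩
  have hN0 : 0 < N := by omega
  have hr := rate_sq hN a
  have hr0 := rate_pos hN a
  set ρ := rate N a
  set q := a - b + 1 with hqdef
  set p := -(N : ℝ) / 2 + a + ε * ρ with hp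
  set U := radialField 𝕜 N p q γ β
  have hq0 : q ≠ 0 := fun h => by simp [h] at hq
  -- `b₀` is the rate of the exponential in `|U|²`, and `z` the Gamma exponent of the three integrals.
  obtain ⟨b₀, hb₀⟩ : ∃ b₀, b₀ = 2 * β / q := ⟨_, rfl⟩
  obtain ⟨z, hz⟩ : ∃ z, z = 2 * (ε * ρ) / q := ⟨_, rfl⟩
  have hbq : b₀ * q = 2 * β := by rw [hb₀]; field_simp
  have hqz : q * z = 2 * (ε * ρ) := by rw [hz]; field_simp
  have hq2 : 0 < q ^ 2 := by positivity
  have hb : 0 < b₀ := by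
    refine pos_of_mul_pos_left (b := q ^ 2) ?_ hq2.le
    have : b₀ * q ^ 2 = 2 * (β * q) := by linear_combination q * hbq
    linarith
  have hz0 : 0 < z := by
    refine pos_of_mul_pos_left (b := q ^ 2) ?_ hq2.le
    have : z * q ^ 2 = 2 * (ε * q * ρ) := by linear_combination q * hqz
    have := mul_pos hq hr0
    linarith
  have i0 := integrable_gammaProfile hN0 hq0 hb hz0
  have i1 := integrable_gammaProfile (z := z + 1) hN0 hq0 hb (by linarith)
  have i2 := integrable_gammaProfile (z := z + 2) hN0 hq0 hb (by linarith)
  have dA : ∀ x, x ≠ 0 → γ ^ 2 * (((1 + p) ^ 2 + (N - 1)) * gammaProfile N q b₀ z x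
      - 2 * (1 + p) * β * gammaProfile N q b₀ (z + 1) x
      + β ^ 2 * gammaProfile N q b₀ (z + 2) x) = gradDensity a U x := fun x hx => by
    rw [gradDensity_radialField 𝕜 hq0 hx a z (by linarith), hb₀]
  have dB : ∀ x, x ≠ 0 → γ ^ 2 * gammaProfile N q b₀ (z + 2) x = density (2 * b) U x :=
    fun x hx => by
    rw [density_radialField 𝕜 hx (2 * b) (z + 2) (by linarith), hb₀]
  have dM : ∀ x, x ≠ 0 → γ ^ 2 * gammaProfile N q b₀ (z + 1) x = density (a + b + 1) U x :=
    fun x hx => by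
    rw [density_radialField 𝕜 hx (a + b + 1) (z + 1) (by linarith), hb₀]
  have iA := (((i0.const_mul ((1 + p) ^ 2 + (N - 1))).sub (i1.const_mul (2 * (1 + p) * β))).add
    (i2.const_mul (β ^ 2))).const_mul (γ ^ 2)
  have iA' : Integrable fun x : Pt N => ((1 + p) ^ 2 + (N - 1)) * gammaProfile N q b₀ z x
      - 2 * (1 + p) * β * gammaProfile N q b₀ (z + 1) x :=
    (i0.const_mul _).sub (i1.const_mul _)
  have A : ∫ x, gradDensity a U x = γ ^ 2 * (((1 + p) ^ 2 + (N - 1)) * (∫ x, gammaProfile N q b₀ z x)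
      - 2 * (1 + p) * β * (∫ x, gammaProfile N q b₀ (z + 1) x)
      + β ^ 2 * ∫ x, gammaProfile N q b₀ (z + 2) x) := by
    rw [← integral_congr_off dA, integral_const_mul, integral_add iA' (i2.const_mul _),
      integral_sub (i0.const_mul _) (i1.const_mul _), integral_const_mul, integral_const_mul,
      integral_const_mul]
  have B : ∫ x, density (2 * b) U x = γ ^ 2 * ∫ x, gammaProfile N q b₀ (z + 2) x := by
    rw [← integral_congr_off dB, integral_const_mul]
  have M : ∫ x, density (a + b + 1) U x = γ ^ 2 * ∫ x, gammaProfile N q b₀ (z + 1) x := by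
    rw [← integral_congr_off dM, integral_const_mul]
  have hb' : 0 < β / q := by
    have : β / q = b₀ / 2 := by rw [hb₀]; ring
    rw [this]; positivity
  have l0 : ∀ᶠ x : Pt N in 𝓝[≠] 0, x ≠ 0 := eventually_mem_nhdsWithin
  have li : ∀ᶠ x : Pt N in Bornology.cobounded _, x ≠ 0 := Bornology.eventually_ne_cobounded 0
  have t1 := tendsto_norm_rpow_mul_exp (N := N) hq0 hb' (show 0 < z / 2 by positivity)
  have t2 := tendsto_norm_rpow_mul_exp (N := N) hq0 hb' (show 0 < z / 2 + 1 by positivity)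
  have hmem : MemX a b U := by
    refine ⟨contDiffOn_radialField 𝕜, ?_, ?_, ?_, ?_, ?_, ?_, ?_⟩
    · refine iA.congr ?_
      filter_upwards [ae_ne_zero] with x hx using dA x hx
    · refine (i2.const_mul (γ ^ 2)).congr ?_
      filter_upwards [ae_ne_zero] with x hx using dB x hx
    · refine (i1.const_mul (γ ^ 2)).congr ?_
      filter_upwards [ae_ne_zero] with x hx using dM x hx
    · exact tendsto_radialField 𝕜 l0 (by linarith) t1.1
    · exact tendsto_radialField 𝕜 li (by linarith) t1.2
    · exact tendsto_radialField 𝕜 l0 (by linarith) t2.1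
    · exact tendsto_radialField 𝕜 li (by linarith) t2.2
  refine ⟨⟨hmem, curlFree_radialField 𝕜 hq0, ?_⟩, fun hγ => ?_⟩
  · have j1 := integral_gammaProfile_add_one hN0 hq0 hb hz0
    have j2 := integral_gammaProfile_add_one hN0 hq0 hb (show 0 < z + 1 by linarith)
    rw [add_assoc, one_add_one_eq_two] at j2
    rw [A, B, M]
    generalize (∫ x : Pt N, gammaProfile N q b₀ z x) = J₀ at j1 ⊢
    generalize (∫ x : Pt N, gammaProfile N q b₀ (z + 1) x) = J₁ at j1 j2 ⊢
    generalize (∫ x : Pt N, gammaProfile N q b₀ (z + 2) x) = J₂ at j2 ⊢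
    have k1 : ε * ρ * J₀ = β * J₁ := by
      linear_combination (-J₀ / 2) * hqz + (J₁ / 2) * hbq - (q / 2) * j1
    have k2 : β * J₂ = (ε * ρ + q / 2) * J₁ := by
      linear_combination (-J₂ / 2) * hbq + (J₁ / 2) * hqz + (q / 2) * j2
    have k3 : (1 + p) ^ 2 + (N - 1 : ℝ) = 2 * (1 + p) * (ε * ρ) := by
      rw [hp]
      linear_combination -hr - ρ ^ 2 * hε
    have k4 : ((1 + p) ^ 2 + (N - 1 : ℝ)) * J₀ - 2 * (1 + p) * β * J₁ + β ^ 2 * J₂ =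
        β * ((ε * ρ + q / 2) * J₁) := by
      rw [k3]
      linear_combination 2 * (1 + p) * k1 + β * k2
    rw [k4]
    linear_combination γ ^ 4 * (ε * ρ + q / 2) * J₁ * k2
  · rw [M]
    have := integral_gammaProfile_pos (z := z + 1) hN0 hq0 hb (by linarith)
    positivity

/-- The constant is attained, so no larger one is admissible. -/
theorem isGreatest_admissible (hN : 2 ≤ N) {a b ε : ℝ}
    (h : ((N : ℝ) / 2 - a) ^ 2 ≥ N + 1) (hε : ε ^ 2 = 1) (hq : 0 < ε * (a - b + 1)) :
    IsGreatest {K : ℝ | Admissible 𝕜 N a b K} ((ε * rate N a + (a - b + 1) / 2) ^ 2) := by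
  refine ⟨admissible_of_sign 𝕜 hN h hε hq, fun K hK => ?_⟩
  obtain ⟨⟨hmem, hcurl, heq⟩, hpos⟩ := isExtremal_radialField 𝕜 hN hε hq 1 hq
  have h1 := hK _ hmem hcurl
  have h2 := hpos one_ne_zero
  rw [heq] at h1
  exact le_of_mul_le_mul_right h1 (by positivity)

end Equality

end CKN

end

theorem theorem1 (𝕜 : Type*) [RCLike 𝕜] (N : ℕ) (hN : 2 ≤ N) (a b : ℝ)
    (h : ((N : ℝ) / 2 - a) ^ 2 ≥ (N : ℝ) + 1) :
    (a - b + 1 > 0 →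
      IsGreatest {K : ℝ | CKN.Admissible 𝕜 N a b K}
        ((CKN.rate N a + (a - b + 1) / 2) ^ 2) ∧
      ∀ γ β : ℝ, β > 0 →
        CKN.IsExtremal a b ((CKN.rate N a + (a - b + 1) / 2) ^ 2)
          (CKN.radialField 𝕜 N (-(N : ℝ) / 2 + a + CKN.rate N a) (a - b + 1) γ β) ∧
        (γ ≠ 0 → 0 < ∫ x, CKN.density (a + b + 1)
          (CKN.radialField 𝕜 N (-(N : ℝ) / 2 + a + CKN.rate N a) (a - b + 1) γ β) x)) ∧
    (a - b + 1 < 0 →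
      IsGreatest {K : ℝ | CKN.Admissible 𝕜 N a b K}
        ((CKN.rate N a - (a - b + 1) / 2) ^ 2) ∧
      ∀ γ β : ℝ, β < 0 →
        CKN.IsExtremal a b ((CKN.rate N a - (a - b + 1) / 2) ^ 2)
          (CKN.radialField 𝕜 N (-(N : ℝ) / 2 + a - CKN.rate N a) (a - b + 1) γ β) ∧
        (γ ≠ 0 → 0 < ∫ x, CKN.density (a + b + 1)
          (CKN.radialField 𝕜 N (-(N : ℝ) / 2 + a - CKN.rate N a) (a - b + 1) γ β) x)) := by
  constructor
  · intro hq
    have hq' : 0 < (1 : ℝ) * (a - b + 1) := by linarith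
    have h1 := CKN.isGreatest_admissible 𝕜 hN h (one_pow 2) hq'
    rw [one_mul] at h1
    refine ⟨h1, fun γ β hβ => ?_⟩
    have h2 := CKN.isExtremal_radialField 𝕜 hN (one_pow 2) hq' γ (mul_pos hβ hq)
    rwa [one_mul] at h2
  · intro hq
    have hq' : 0 < (-1 : ℝ) * (a - b + 1) := by linarith
    have e : (CKN.rate N a - (a - b + 1) / 2) ^ 2 =
        (-1 * CKN.rate N a + (a - b + 1) / 2) ^ 2 := by ring
    have e' : -(N : ℝ) / 2 + a - CKN.rate N a = -(N : ℝ) / 2 + a + -1 * CKN.rate N a := by ring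
    rw [e, e']
    exact ⟨CKN.isGreatest_admissible 𝕜 hN h (by norm_num) hq', fun γ β hβ =>
      CKN.isExtremal_radialField 𝕜 hN (by norm_num) hq' γ (mul_pos_of_neg_of_neg hβ hq)⟩
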